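/- Let $\sigma:[0,\infty)\to[0,\infty)$ be continuous and consider $$\partial_t u+\sigma(\partial_x u)\,\partial_x u\,H[\partial_x u]=0\quad\text{in }(0,\infty)\times\mathbb R, \qquad (E)$$ where $H[\partial_x u]=A_0[u]$, $A_0[f](x)=\mathrm{p.v.}\int_{\mathbb R}\frac{f(x)-f(y)}{(x-y)^2}dy$. For $0<\delta\le\infty$ put $A_\delta[f](x)=\int_{|x-y|\ge\delta}\frac{f(x)-f(y)}{(x-y)^2}dy$ and $A_{-\delta}[f](x)=\mathrm{p.v.}\int_{|x-y|<\delta}\frac{f(x)-f(y)}{(x-y)^2}dy$. All functions below are real-valued on $[0,\infty)\times\mathbb R$, non-decreasing in $x$, and bounded on $[0,T]\times\mathbb R$ for every $T>0$. An upper semicontinuous (resp. lower semicontinuous) function $u$ is a viscosity sub-solution (resp. super-solution) of $(E)$ if for all $T>0$, all $\phi\in C^{1,1}_b$ (bounded $C^1$ functions on $\mathbb R^2$ with bounded Lipschitz gradient), all $0<\delta\le\infty$, and every point $(t_0,x_0)\in(0,T]\times\mathbb R$ of maximum (resp. minimum) of $u-\phi$ over $[0,T]\times\mathbb R$, $$\partial_t\phi(t_0,x_0)+\sigma(\partial_x\phi(t_0,x_0))\,\partial_x\phi(t_0,x_0)\Big(A_{-\delta}[\phi(t_0,\cdot)](x_0)+A_\delta[u(t_0,\cdot)](x_0)\Big)\le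 0\quad(\text{resp. }\ge 0)$$ (at such a point $\partial_x\phi(t_0,x_0)\ge0$ because $u$ is non-decreasing in $x$). Write $u^*$, $u_*$ for the upper and lower semicontinuous envelopes; $u$ is a viscosity solution of $(E)$ if $u^*$ is a sub-solution and $u_*$ is a super-solution. It has the non-decreasing initial datum $u_0:\mathbb R\to\mathbb R$ if $u^*(0,\cdot)=(u_0)^*$ and $u_*(0,\cdot)=(u_0)_*$. 1. (Comparison) If $u_1$ is a super-solution and $u_2$ a sub-solution of $(E)$ with $u_1(0,x)\ge u_2(0,x)$ for all $x\in\mathbb R$, then $u_1(t,x)\ge u_2(t,x)$ for all $t\ge0$, $x\in\mathbb R$. 2. (Uniqueness) For every non-decreasing $u_0$ there is at most one viscosity solution of $(E)$ with initial datum $u_0$, up to the values at points of discontinuity: if $u,v$ are two of them, then $u^*=v^*$ and $u_*=v_*$. If moreover $u_0$ is continuous, or if $u$ and $v$ are both right-continuous in $x$, then $u=v$ everywhere. -/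

import Mathlib

open Set Filter Topology MeasureTheory
open scoped NNReal ENNReal

noncomputable section

namespace DysonSigma

/-- Lower semicontinuous envelope `u_*(p) = liminf_{q → p} u(q)`
(the value `q = p` is included in the limit). -/
def lowerEnvelope {X : Type*} [TopologicalSpace X] (u : X → ℝ) (p : X) : ℝ :=
  liminf u (𝓝 p)

/-- Upper semicontinuous envelope `u^*(p) = limsup_{q → p} u(q)`
(the value `q = p` is included in the limit). -/
def upperEnvelope {X : Type*} [TopologicalSpace X] (u : X → ℝ) (p : X) : ℝ :=
  limsup u (𝓝 p)

/-- `A_δ[f](x) = ∫_{|x - y| ≥ δ} (f x - f y) / (x - y)² dy`, for `0 < δ ≤ ∞`.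
The integral converges absolutely for every bounded measurable `f`; it is `0` for `δ = ∞`. -/
def halfLaplacianFar (δ : ℝ≥0∞) (f : ℝ → ℝ) (x : ℝ) : ℝ :=
  ∫ y in {y : ℝ | δ ≤ edist x y}, (f x - f y) / (x - y) ^ 2

/-- The integral of `(f x - f y) / (x - y)²` over `ε ≤ |x - y|`, `|x - y| < δ`. -/
def halfLaplacianAnnulus (δ : ℝ≥0∞) (ε : ℝ) (f : ℝ → ℝ) (x : ℝ) : ℝ :=
  ∫ y in {y : ℝ | ε ≤ |x - y| ∧ edist x y < δ}, (f x - f y) / (x - y) ^ 2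

/-- `A_{-δ}[f](x) = p.v. ∫_{|x - y| < δ} (f x - f y) / (x - y)² dy`, for `0 < δ ≤ ∞`.
The integral is understood as a principal value; the limit exists for the test functions
below, see `tendsto_halfLaplacianAnnulus`. -/
def halfLaplacianNear (δ : ℝ≥0∞) (f : ℝ → ℝ) (x : ℝ) : ℝ :=
  limUnder (𝓝[>] (0 : ℝ)) (fun ε => halfLaplacianAnnulus δ ε f x)

theorem abs_second_difference_le {f : ℝ → ℝ} {K : ℝ≥0} (hf : Differentiable ℝ f)
    (hK : LipschitzWith K (deriv f)) (x z : ℝ) :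
    |2 * f x - f (x + z) - f (x - z)| ≤ 2 * K * z ^ 2 := by
  have key : ∀ w : ℝ, |f (x + w) - f x - deriv f x * w| ≤ K * w ^ 2 := by
    intro w
    have hd : ∀ s ∈ uIcc 0 w, HasDerivWithinAt (fun s => f (x + s) - deriv f x * s)
        (deriv f (x + s) - deriv f x) (uIcc 0 w) s := by
      intro s _
      have h1 : HasDerivAt (fun s => f (x + s)) (deriv f (x + s)) s := by
        simpa using (hf (x + s)).hasDerivAt.comp_const_add x s
      have h2 : HasDerivAt (fun s => deriv f x * s) (deriv f x) s := by
        simpa using (hasDerivAt_id s).const_mul (deriv f x)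
      exact (h1.sub h2).hasDerivWithinAt
    have hb : ∀ s ∈ uIcc 0 w, ‖deriv f (x + s) - deriv f x‖ ≤ K * |w| := by
      intro s hs
      have h1 := hK.dist_le_mul (x + s) x
      rw [dist_eq_norm, dist_eq_norm] at h1
      have h2 : ‖x + s - x‖ = |s| := by rw [add_sub_cancel_left, Real.norm_eq_abs]
      have h3 : |s| ≤ |w| := by
        have := abs_sub_left_of_mem_uIcc hs
        simpa using this
      rw [h2] at h1
      exact h1.trans (mul_le_mul_of_nonneg_left h3 K.2)
    have := (convex_uIcc (0 : ℝ) w).norm_image_sub_le_of_norm_hasDerivWithin_le hd hb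
      left_mem_uIcc right_mem_uIcc
    simp only [Real.norm_eq_abs, add_zero, mul_zero, sub_zero] at this
    calc |f (x + w) - f x - deriv f x * w|
        = |f (x + w) - deriv f x * w - f x| := by congr 1; ring
      _ ≤ K * |w| * |w| := this
      _ = K * w ^ 2 := by rw [mul_assoc, abs_mul_abs_self]; ring
  have h1 := abs_le.1 (key z)
  have h2 := abs_le.1 (key (-z))
  rw [← sub_eq_add_neg] at h2
  rw [abs_le]
  constructor <;> nlinarith [h1.1, h1.2, h2.1, h2.2]

theorem tendsto_halfLaplacianAnnulus_aux {f : ℝ → ℝ} {K : ℝ≥0} {C : ℝ} (hf : Differentiable ℝ f)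
    (hC : ∀ y, |f y| ≤ C) (hK : LipschitzWith K (deriv f)) (δ : ℝ≥0∞) (x : ℝ) :
    Tendsto (fun ε => halfLaplacianAnnulus δ ε f x) (𝓝[>] (0 : ℝ))
      (𝓝 (∫ z in {z : ℝ | edist 0 z < δ}, (2 * f x - f (x + z) - f (x - z)) / (2 * z ^ 2))) := by
  have hm : ∀ ε : ℝ, MeasurableSet {z : ℝ | ε ≤ |z| ∧ edist 0 z < δ} := fun ε =>
    MeasurableSet.inter (s₁ := {z : ℝ | ε ≤ |z|}) (s₂ := {z : ℝ | edist 0 z < δ})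
      (measurableSet_le measurable_const (by fun_prop))
      (measurableSet_lt (by fun_prop) measurable_const)
  have hmδ : MeasurableSet {z : ℝ | edist 0 z < δ} :=
    measurableSet_lt (by fun_prop) measurable_const
  have hfm : Measurable f := hf.continuous.measurable
  have hC0 : 0 ≤ C := (abs_nonneg _).trans (hC 0)
  have hI : Integrable (fun z : ℝ => (1 + z ^ 2)⁻¹) := integrable_inv_one_add_sq
  -- absolute convergence away from the singularity
  have hint : ∀ ε : ℝ, 0 < ε → IntegrableOn (fun z => (f x - f (x + z)) / z ^ 2)
      {z : ℝ | ε ≤ |z| ∧ edist 0 z < δ} := by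
    intro ε hε
    refine Integrable.mono' (hI.const_mul (2 * C * (1 + 1 / ε ^ 2))).integrableOn
      (Measurable.aestronglyMeasurable (by fun_prop)) ?_
    refine (ae_restrict_iff' (hm ε)).2 (Eventually.of_forall ?_)
    rintro z ⟨hz, -⟩
    have hz2 : ε ^ 2 ≤ z ^ 2 := by rw [← sq_abs z]; gcongr
    have hzp : 0 < z ^ 2 := lt_of_lt_of_le (by positivity) hz2
    rw [Real.norm_eq_abs, abs_div, abs_of_pos hzp, div_le_iff₀ hzp]
    have h1 : |f x - f (x + z)| ≤ 2 * C := by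
      have := abs_sub (f x) (f (x + z))
      linarith [hC x, hC (x + z)]
    have h2 : 1 ≤ (1 + 1 / ε ^ 2) * (1 + z ^ 2)⁻¹ * z ^ 2 := by
      rw [← div_eq_mul_inv, div_mul_eq_mul_div, one_le_div (by positivity)]
      have : 1 ≤ 1 / ε ^ 2 * z ^ 2 := by
        rw [div_mul_eq_mul_div, one_le_div (by positivity)]; linarith
      linarith
    nlinarith
  -- symmetrization
  have hsym : ∀ ε : ℝ, 0 < ε → halfLaplacianAnnulus δ ε f x =
      ∫ z in {z : ℝ | edist 0 z < δ}, {z : ℝ | ε ≤ |z|}.indicator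
        (fun z => (2 * f x - f (x + z) - f (x - z)) / (2 * z ^ 2)) z := by
    intro ε hε
    have e1 : halfLaplacianAnnulus δ ε f x =
        ∫ z in {z : ℝ | ε ≤ |z| ∧ edist 0 z < δ}, (f x - f (x + z)) / z ^ 2 := by
      have hs : (fun z : ℝ => x + z) ⁻¹' {y : ℝ | ε ≤ |x - y| ∧ edist x y < δ} =
          {z : ℝ | ε ≤ |z| ∧ edist 0 z < δ} := by
        ext z
        have : edist x (x + z) = edist 0 z := by
          rw [edist_dist, edist_dist, Real.dist_eq, Real.dist_eq]; simp
        simp [this]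
      have := (measurePreserving_add_left volume x).setIntegral_preimage_emb
        (measurableEmbedding_addLeft x)
        (fun y => (f x - f y) / (x - y) ^ 2) {y : ℝ | ε ≤ |x - y| ∧ edist x y < δ}
      rw [halfLaplacianAnnulus, ← this, hs]
      simp
    have e2 : ∫ z in {z : ℝ | ε ≤ |z| ∧ edist 0 z < δ}, (f x - f (x + z)) / z ^ 2 =
        ∫ z in {z : ℝ | ε ≤ |z| ∧ edist 0 z < δ}, (f x - f (x - z)) / z ^ 2 := by
      have hs : (fun z : ℝ => -z) ⁻¹' {z : ℝ | ε ≤ |z| ∧ edist 0 z < δ} =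
          {z : ℝ | ε ≤ |z| ∧ edist 0 z < δ} := by
        ext z
        have : edist 0 (-z) = edist 0 z := by
          rw [edist_dist, edist_dist, Real.dist_eq, Real.dist_eq]; simp
        simp only [mem_preimage, mem_ofPred_eq, abs_neg, this]
      have := (Measure.measurePreserving_neg (volume : Measure ℝ)).setIntegral_preimage_emb
        (MeasurableEquiv.neg ℝ).measurableEmbedding
        (fun z => (f x - f (x + z)) / z ^ 2) {z : ℝ | ε ≤ |z| ∧ edist 0 z < δ}
      rw [← this, hs]
      simp [sub_eq_add_neg]
    have hint' : IntegrableOn (fun z => (f x - f (x - z)) / z ^ 2)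
        {z : ℝ | ε ≤ |z| ∧ edist 0 z < δ} := by
      have h := (hint ε hε).integrable_indicator (hm ε)
      rw [← integrable_indicator_iff (hm ε)]
      refine (h.comp_neg).congr (Eventually.of_forall fun z => ?_)
      simp [indicator, sub_eq_add_neg]
    rw [setIntegral_indicator (measurableSet_le measurable_const (by fun_prop)), e1]
    have hset : {z : ℝ | edist 0 z < δ} ∩ {z : ℝ | ε ≤ |z|} =
        {z : ℝ | ε ≤ |z| ∧ edist 0 z < δ} := by
      ext z; exact and_comm
    rw [hset]
    have e3 : ∫ z in {z : ℝ | ε ≤ |z| ∧ edist 0 z < δ}, (f x - f (x + z)) / z ^ 2 =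
        (1 / 2) * ((∫ z in {z : ℝ | ε ≤ |z| ∧ edist 0 z < δ}, (f x - f (x + z)) / z ^ 2) +
          ∫ z in {z : ℝ | ε ≤ |z| ∧ edist 0 z < δ}, (f x - f (x - z)) / z ^ 2) := by
      rw [← e2]; ring
    rw [e3, ← integral_add (hint ε hε) hint', ← integral_const_mul]
    congr 1
    ext z
    rw [← add_div, mul_comm 2 (z ^ 2), ← div_div]
    ring
  have hcongr : (fun ε => ∫ z in {z : ℝ | edist 0 z < δ}, {z : ℝ | ε ≤ |z|}.indicator
        (fun z => (2 * f x - f (x + z) - f (x - z)) / (2 * z ^ 2)) z) =ᶠ[𝓝[>] (0 : ℝ)]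
      (fun ε => halfLaplacianAnnulus δ ε f x) := by
    filter_upwards [self_mem_nhdsWithin] with ε hε using (hsym ε hε).symm
  refine Tendsto.congr' hcongr ?_
  refine tendsto_integral_filter_of_dominated_convergence
    (fun z => (2 * K + 4 * C) * (1 + z ^ 2)⁻¹) ?_ ?_ (hI.const_mul _).integrableOn ?_
  · refine Eventually.of_forall fun ε => Measurable.aestronglyMeasurable ?_
    exact Measurable.indicator (by fun_prop) (measurableSet_le measurable_const (by fun_prop))
  · refine Eventually.of_forall fun ε => Eventually.of_forall fun z => ?_
    refine (norm_indicator_le_norm_self _ _).trans ?_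
    rcases eq_or_ne z 0 with rfl | hz
    · simp; positivity
    have hzp : 0 < z ^ 2 := by positivity
    rw [Real.norm_eq_abs, abs_div, abs_of_pos (by positivity : 0 < 2 * z ^ 2),
      ← div_eq_mul_inv, div_le_div_iff₀ (by positivity) (by positivity)]
    have h1 := abs_second_difference_le hf hK x z
    have h2 : |2 * f x - f (x + z) - f (x - z)| ≤ 4 * C := by
      have a := abs_le.1 (hC x)
      have b := abs_le.1 (hC (x + z))
      have c := abs_le.1 (hC (x - z))
      rw [abs_le]; constructor <;> linarith
    have hK0 : (0 : ℝ) ≤ K := K.2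
    nlinarith [mul_le_mul_of_nonneg_right h2 hzp.le, mul_nonneg hK0 hzp.le,
      mul_nonneg hC0 hzp.le]
  · refine Eventually.of_forall fun z => ?_
    rcases eq_or_ne z 0 with rfl | hz
    · simp [indicator]
    refine tendsto_const_nhds.congr' ?_
    have : ∀ᶠ ε : ℝ in 𝓝[>] (0 : ℝ), ε ≤ |z| :=
      nhdsWithin_le_nhds (eventually_le_nhds (abs_pos.2 hz))
    filter_upwards [this] with ε hε
    rw [indicator_of_mem (by exact hε)]

/-- The class `C^{1,1}_b` on `ℝ × ℝ` (time, space): bounded `C¹` functions whose gradient is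
bounded and Lipschitz continuous. -/
structure IsTestFunction (φ : ℝ × ℝ → ℝ) : Prop where
  differentiable : Differentiable ℝ φ
  bounded : ∃ C : ℝ, ∀ p, |φ p| ≤ C
  bounded_fderiv : ∃ C : ℝ, ∀ p, ‖fderiv ℝ φ p‖ ≤ C
  lipschitz_fderiv : ∃ K : ℝ≥0, LipschitzWith K (fderiv ℝ φ)

/-- The principal value defining `A_{-δ}[φ(t)](x)` exists for every test function, and is given by
an absolutely convergent symmetrized integral. -/
theorem tendsto_halfLaplacianAnnulus {φ : ℝ × ℝ → ℝ} (hφ : IsTestFunction φ) (δ : ℝ≥0∞)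
    (t x : ℝ) :
    Tendsto (fun ε => halfLaplacianAnnulus δ ε (fun y => φ (t, y)) x) (𝓝[>] (0 : ℝ))
      (𝓝 (∫ z in {z : ℝ | edist 0 z < δ},
        (2 * φ (t, x) - φ (t, x + z) - φ (t, x - z)) / (2 * z ^ 2))) := by
  obtain ⟨C, hC⟩ := hφ.bounded
  obtain ⟨K, hK⟩ := hφ.lipschitz_fderiv
  have hd : ∀ y, HasDerivAt (fun y => φ (t, y)) (fderiv ℝ φ (t, y) (0, 1)) y := fun y =>
    (hφ.differentiable (t, y)).hasFDerivAt.comp_hasDerivAt y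
      ((hasDerivAt_const y t).prodMk (hasDerivAt_id y))
  refine tendsto_halfLaplacianAnnulus_aux (K := K) (C := C) (fun y => (hd y).differentiableAt)
    (fun y => hC (t, y)) (LipschitzWith.of_dist_le_mul fun y y' => ?_) δ x
  rw [(hd y).deriv, (hd y').deriv, dist_eq_norm, ← sub_apply]
  refine (ContinuousLinearMap.le_opNorm _ _).trans ?_
  have h1 : ‖((0 : ℝ), (1 : ℝ))‖ = 1 := by simp [Prod.norm_def]
  have h2 := hK.dist_le_mul (t, y) (t, y')
  rw [dist_eq_norm] at h2
  have h3 : dist (t, y) (t, y') = dist y y' := by simp [Prod.dist_eq]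
  rw [h1, mul_one]
  rwa [h3] at h2

/-- The time derivative of `φ` at `(t, x)`. -/
def partialT (φ : ℝ × ℝ → ℝ) (t x : ℝ) : ℝ := deriv (fun s => φ (s, x)) t

/-- The space derivative of `φ` at `(t, x)`. -/
def partialX (φ : ℝ × ℝ → ℝ) (t x : ℝ) : ℝ := deriv (fun y => φ (t, y)) x

/-- The left-hand side of the equation `∂_t u + σ(∂_x u) ∂_x u H[∂_x u] = 0` at `(t, x)`, in its
viscosity form. Recall `H[∂_x u] = A_0[u]`; this is replaced by
`A_{-δ}[φ(t)](x) + A_δ[u(t)](x)`, and the derivatives are those of `φ`.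
(When `u` is non-decreasing in `x` and `u - φ` has an extremum at `(t, x)`, one has
`∂_x φ(t, x) ≥ 0`, so that `Real.toNNReal` is the identity there.) -/
def viscosityOperator (σ : ℝ≥0 → ℝ≥0) (δ : ℝ≥0∞) (u : ℝ≥0 × ℝ → ℝ) (φ : ℝ × ℝ → ℝ)
    (t : ℝ≥0) (x : ℝ) : ℝ :=
  partialT φ t x +
    (σ (partialX φ t x).toNNReal : ℝ) * partialX φ t x *
      (halfLaplacianNear δ (fun y => φ (t, y)) x + halfLaplacianFar δ (fun y => u (t, y)) x)

/-- Viscosity sub-solutions of `∂_t u + σ(∂_x u) ∂_x u H[∂_x u] = 0` in `(0, ∞) × ℝ`. -/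
structure IsViscositySubsolution (σ : ℝ≥0 → ℝ≥0) (u : ℝ≥0 × ℝ → ℝ) : Prop where
  usc : UpperSemicontinuous u
  le_zero : ∀ T : ℝ≥0, 0 < T → ∀ φ : ℝ × ℝ → ℝ, IsTestFunction φ →
    ∀ δ : ℝ≥0∞, 0 < δ → ∀ (t₀ : ℝ≥0) (x₀ : ℝ), 0 < t₀ → t₀ ≤ T →
    IsMaxOn (fun p : ℝ≥0 × ℝ => u p - φ ((p.1 : ℝ), p.2)) {p | p.1 ≤ T} (t₀, x₀) →
    viscosityOperator σ δ u φ t₀ x₀ ≤ 0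

/-- Viscosity super-solutions of `∂_t u + σ(∂_x u) ∂_x u H[∂_x u] = 0` in `(0, ∞) × ℝ`. -/
structure IsViscositySupersolution (σ : ℝ≥0 → ℝ≥0) (u : ℝ≥0 × ℝ → ℝ) : Prop where
  lsc : LowerSemicontinuous u
  zero_le : ∀ T : ℝ≥0, 0 < T → ∀ φ : ℝ × ℝ → ℝ, IsTestFunction φ →
    ∀ δ : ℝ≥0∞, 0 < δ → ∀ (t₀ : ℝ≥0) (x₀ : ℝ), 0 < t₀ → t₀ ≤ T →
    IsMinOn (fun p : ℝ≥0 × ℝ => u p - φ ((p.1 : ℝ), p.2)) {p | p.1 ≤ T} (t₀, x₀) →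
    0 ≤ viscosityOperator σ δ u φ t₀ x₀

/-- Viscosity solutions: locally bounded functions whose upper envelope is a sub-solution and
whose lower envelope is a super-solution. -/
structure IsViscositySolution (σ : ℝ≥0 → ℝ≥0) (u : ℝ≥0 × ℝ → ℝ) : Prop where
  locallyBounded : ∀ p, ∃ C : ℝ, ∀ᶠ q in 𝓝 p, |u q| ≤ C
  upper : IsViscositySubsolution σ (upperEnvelope u)
  lower : IsViscositySupersolution σ (lowerEnvelope u)

/-- `u` is non-decreasing in the space variable. -/
def MonotoneInSpace (u : ℝ≥0 × ℝ → ℝ) : Prop := ∀ t, Monotone (fun x => u (t, x))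

/-- `u` is bounded on `[0, T] × ℝ` for every `T`. -/
def BoundedOnStrips (u : ℝ≥0 × ℝ → ℝ) : Prop :=
  ∀ T : ℝ≥0, ∃ C : ℝ, ∀ t ≤ T, ∀ x, |u (t, x)| ≤ C

/-- `u` takes the initial datum `u₀`, in the sense of envelopes: the envelopes of `u` on
`[0, ∞) × ℝ` are, at time `0`, the envelopes of `u₀` on `ℝ`. For a continuous `u₀` this says that
`u(s, y) → u₀(x)` as `(s, y) → (0, x)`, for every `x`. -/
def HasInitialDatum (u : ℝ≥0 × ℝ → ℝ) (u₀ : ℝ → ℝ) : Prop :=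
  ∀ x, upperEnvelope u (0, x) = upperEnvelope u₀ x ∧
    lowerEnvelope u (0, x) = lowerEnvelope u₀ x

/-- `u` is right-continuous in the space variable. -/
def RightContinuousInSpace (u : ℝ≥0 × ℝ → ℝ) : Prop :=
  ∀ t x, ContinuousWithinAt (fun y => u (t, y)) (Ici x) x

end DysonSigma

end

/-! Comparison is proved by doubling variables. With `S r = r² / (1 + r²)`, maximize `u₂ (t, x) - u₁
(s, y)` minus `N S(t - s) + N S(x - y) + K S(x / R) + η S(t + 1)`. Saturating the square keeps every
penalty an admissible bounded test function, and a large `K` still confines the maximum to a compact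
set.

At a maximum, monotonicity in space forces `y ≤ x`, so `p = N S'(x - y)` is nonnegative and so is
the coefficient `σ(p) p`. The two viscosity inequalities carry the slopes `p` and `p + q`, where
`|q| ≤ K / R`. Moving `x` and `y` by the same `z` leaves `N S(x - y)` unchanged, which orders the
far nonlocal terms up to an error vanishing as `R → ∞`. The near terms are `O(δ)` for fixed `N`.
What survives is a positive lower bound for `η S'(t + 1)`, a contradiction
(`time_derivative_le_of_isMaxOn_doubledFunctional`). Since the equation has no explicit dependence
on `(t, x)`, `N` stays fixed: it only has to bring the two points close together.

The maximum must also avoid the initial time, which needs separation uniform over the noncompact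
line (`exists_initial_separation`). On a compact interval semicontinuity suffices. Near `±∞` a
maximum principle (`le_of_viscosity_inequality`) and monotonicity replace it: a penalty spread over
scale `R` has slope `O(1 / R)`, and the nonlocal term is switched off at zero slope.

For uniqueness the data `(u₀)^*` and `(u₀)_*` are not ordered the right way at jumps, but they are
after any strict translation. Comparing a translate of `u^*` with `v_*` gives `u^*(t, x) ≤ v_*(t,
y)` for `x < y`, and one-sided limits do the rest. -/

noncomputable section

namespace DysonSigma

/-! ### A bounded smooth substitute for the square -/

/-- The function `r² / (1 + r²)`, which behaves like `r²` near `0` and is bounded together with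
its first two derivatives. -/
def saturatedSq (r : ℝ) : ℝ := r ^ 2 / (1 + r ^ 2)

/-- The derivative of `saturatedSq`. -/
def saturatedSqDeriv (r : ℝ) : ℝ := 2 * r / (1 + r ^ 2) ^ 2

theorem hasDerivAt_saturatedSq (r : ℝ) : HasDerivAt saturatedSq (saturatedSqDeriv r) r := by
  have hp : (1 + r ^ 2) ≠ 0 := by positivity
  have h1 : HasDerivAt (fun r : ℝ => r ^ 2) (2 * r) r := by simpa using hasDerivAt_pow 2 r
  refine (h1.div (h1.const_add 1) hp).congr_deriv ?_
  unfold saturatedSqDeriv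
  congr 1
  ring

theorem continuous_saturatedSq : Continuous saturatedSq :=
  continuous_iff_continuousAt.2 fun r => (hasDerivAt_saturatedSq r).continuousAt

@[simp] theorem saturatedSq_zero : saturatedSq 0 = 0 := by simp [saturatedSq]

theorem saturatedSqDeriv_neg (r : ℝ) : saturatedSqDeriv (-r) = -saturatedSqDeriv r := by
  simp only [saturatedSqDeriv, even_two.neg_pow]; ring

theorem saturatedSq_neg (r : ℝ) : saturatedSq (-r) = saturatedSq r := by
  simp only [saturatedSq, even_two.neg_pow]

theorem saturatedSq_nonneg (r : ℝ) : 0 ≤ saturatedSq r := by unfold saturatedSq; positivity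

theorem saturatedSq_le_one (r : ℝ) : saturatedSq r ≤ 1 := by
  rw [saturatedSq, div_le_one (by positivity)]; linarith

theorem saturatedSq_pos {r : ℝ} (hr : r ≠ 0) : 0 < saturatedSq r := by
  unfold saturatedSq; positivity

theorem sq_le_of_saturatedSq_le {r c : ℝ} (h : saturatedSq r ≤ c) (hc : c ≤ 1 / 2) :
    r ^ 2 ≤ 2 * c := by
  rw [saturatedSq, div_le_iff₀ (by positivity)] at h
  nlinarith [sq_nonneg r]

theorem abs_saturatedSqDeriv_le (r : ℝ) : |saturatedSqDeriv r| ≤ 1 := by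
  rw [saturatedSqDeriv, abs_div, abs_of_pos (by positivity : 0 < (1 + r ^ 2) ^ 2),
    div_le_one (by positivity), abs_le]
  constructor <;> nlinarith [sq_nonneg (r - 1), sq_nonneg (r + 1), sq_nonneg (r ^ 2)]

theorem saturatedSqDeriv_nonneg {r : ℝ} (hr : 0 ≤ r) : 0 ≤ saturatedSqDeriv r := by
  unfold saturatedSqDeriv; positivity

/-- The shift by one keeps the derivative away from its zero at the origin, so the time penalty
yields a uniform strict gain on `[0, T]`, including at `t = 0`. -/
theorem le_saturatedSqDeriv_add_one {t T : ℝ} (ht : 0 ≤ t) (htT : t ≤ T) :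
    2 / (1 + (T + 1) ^ 2) ^ 2 ≤ saturatedSqDeriv (t + 1) := by
  unfold saturatedSqDeriv
  gcongr
  linarith

theorem lipschitzWith_saturatedSq : LipschitzWith 1 saturatedSq :=
  lipschitzWith_of_nnnorm_deriv_le (fun r => (hasDerivAt_saturatedSq r).differentiableAt) fun r => by
    rw [(hasDerivAt_saturatedSq r).deriv, ← NNReal.coe_le_coe]
    simpa using abs_saturatedSqDeriv_le r

/-- Both bounds are needed under the kernel `1 / z²`: the constant gives integrability at infinity,
the Lipschitz bound gives smallness after division by `R`. -/
theorem abs_saturatedSq_sub_le (r s : ℝ) : |saturatedSq r - saturatedSq s| ≤ min 1 |r - s| := by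
  refine le_min ?_ ?_
  · rw [abs_le]
    constructor <;> linarith [saturatedSq_nonneg r, saturatedSq_nonneg s, saturatedSq_le_one r,
      saturatedSq_le_one s]
  · simpa [Real.dist_eq] using lipschitzWith_saturatedSq.dist_le_mul r s

theorem hasDerivAt_saturatedSqDeriv (r : ℝ) :
    HasDerivAt saturatedSqDeriv ((2 - 6 * r ^ 2) / (1 + r ^ 2) ^ 3) r := by
  have hp : (1 + r ^ 2) ≠ 0 := by positivity
  have h1 : HasDerivAt (fun r : ℝ => (1 + r ^ 2) ^ 2) (2 * (1 + r ^ 2) * (2 * r)) r := by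
    have : HasDerivAt (fun r : ℝ => r ^ 2) (2 * r) r := by simpa using hasDerivAt_pow 2 r
    simpa using! (this.const_add 1).pow 2
  refine (((hasDerivAt_id r).const_mul 2).div h1 (pow_ne_zero 2 hp)).congr_deriv ?_
  simp only [id]
  field_simp
  ring

theorem lipschitzWith_saturatedSqDeriv : LipschitzWith 2 saturatedSqDeriv :=
  lipschitzWith_of_nnnorm_deriv_le
    (fun r => (hasDerivAt_saturatedSqDeriv r).differentiableAt) fun r => by
    rw [(hasDerivAt_saturatedSqDeriv r).deriv, ← NNReal.coe_le_coe]
    have hr := sq_nonneg r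
    simp only [coe_nnnorm, Real.norm_eq_abs, NNReal.coe_ofNat]
    rw [abs_div, abs_of_pos (by positivity : 0 < (1 + r ^ 2) ^ 3), div_le_iff₀ (by positivity),
      abs_le]
    have : 1 + 3 * r ^ 2 ≤ (1 + r ^ 2) ^ 3 := by
      nlinarith [pow_nonneg hr 2, pow_nonneg hr 3]
    constructor <;> linarith

theorem abs_second_difference_saturatedSq_le (x z : ℝ) :
    |2 * saturatedSq x - saturatedSq (x + z) - saturatedSq (x - z)| ≤ 4 * z ^ 2 := by
  have hd : deriv saturatedSq = saturatedSqDeriv := funext fun r => (hasDerivAt_saturatedSq r).deriv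
  have := abs_second_difference_le (K := 2)
    (fun r => (hasDerivAt_saturatedSq r).differentiableAt)
    (hd ▸ lipschitzWith_saturatedSqDeriv) x z
  norm_num at this
  exact this

/-! ### Test functions -/

theorem IsTestFunction.add {φ ψ : ℝ × ℝ → ℝ} (hφ : IsTestFunction φ) (hψ : IsTestFunction ψ) :
    IsTestFunction (fun p => φ p + ψ p) := by
  have hd : fderiv ℝ (fun p => φ p + ψ p) = fun p => fderiv ℝ φ p + fderiv ℝ ψ p :=
    funext fun p => fderiv_fun_add (hφ.differentiable p) (hψ.differentiable p)
  obtain ⟨C₁, h₁⟩ := hφ.bounded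
  obtain ⟨C₂, h₂⟩ := hψ.bounded
  obtain ⟨D₁, h₃⟩ := hφ.bounded_fderiv
  obtain ⟨D₂, h₄⟩ := hψ.bounded_fderiv
  obtain ⟨K₁, h₅⟩ := hφ.lipschitz_fderiv
  obtain ⟨K₂, h₆⟩ := hψ.lipschitz_fderiv
  refine ⟨hφ.differentiable.add hψ.differentiable, ⟨C₁ + C₂, fun p => ?_⟩, ⟨D₁ + D₂, fun p => ?_⟩,
    ⟨K₁ + K₂, ?_⟩⟩
  · exact (abs_add_le _ _).trans (add_le_add (h₁ p) (h₂ p))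
  · rw [hd]; exact (norm_add_le _ _).trans (add_le_add (h₃ p) (h₄ p))
  · rw [hd]; exact h₅.add h₆

theorem IsTestFunction.neg {φ : ℝ × ℝ → ℝ} (hφ : IsTestFunction φ) :
    IsTestFunction (fun p => -φ p) := by
  have hd : fderiv ℝ (fun p => -φ p) = fun p => -fderiv ℝ φ p := funext fun p => fderiv_fun_neg
  obtain ⟨C, hC⟩ := hφ.bounded
  obtain ⟨D, hD⟩ := hφ.bounded_fderiv
  obtain ⟨K, hK⟩ := hφ.lipschitz_fderiv
  refine ⟨hφ.differentiable.neg, ⟨C, fun p => by simpa using hC p⟩, ⟨D, fun p => ?_⟩, ⟨K, ?_⟩⟩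
  · rw [hd]; simpa using hD p
  · rw [hd]; exact hK.neg

theorem IsTestFunction.comp_add_const {φ : ℝ × ℝ → ℝ} (hφ : IsTestFunction φ) (c : ℝ × ℝ) :
    IsTestFunction (fun p => φ (p + c)) := by
  have hd : fderiv ℝ (fun p => φ (p + c)) = fun p => fderiv ℝ φ (p + c) :=
    funext fun p => fderiv_comp_add_right c
  obtain ⟨C, hC⟩ := hφ.bounded
  obtain ⟨D, hD⟩ := hφ.bounded_fderiv
  obtain ⟨K, hK⟩ := hφ.lipschitz_fderiv
  refine ⟨hφ.differentiable.comp (differentiable_id.add_const c), ⟨C, fun p => hC _⟩,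
    ⟨D, fun p => ?_⟩, ⟨K, LipschitzWith.of_dist_le_mul fun p q => ?_⟩⟩
  · rw [hd]; exact hD _
  · rw [hd]; simpa using hK.dist_le_mul (p + c) (q + c)

theorem isTestFunction_saturatedSq (c a b d : ℝ) :
    IsTestFunction (fun p => c * saturatedSq (a * p.1 + b * p.2 + d)) := by
  set L : ℝ × ℝ →L[ℝ] ℝ := a • ContinuousLinearMap.fst ℝ ℝ ℝ + b • ContinuousLinearMap.snd ℝ ℝ ℝ
    with hL
  have hLd : ∀ p : ℝ × ℝ, HasFDerivAt (fun p : ℝ × ℝ => a * p.1 + b * p.2 + d) L p := fun p =>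
    L.hasFDerivAt.add_const d
  have hd : ∀ p : ℝ × ℝ, HasFDerivAt (fun p : ℝ × ℝ => c * saturatedSq (a * p.1 + b * p.2 + d))
      (c • saturatedSqDeriv (a * p.1 + b * p.2 + d) • L) p := fun p =>
    ((hasDerivAt_saturatedSq _).comp_hasFDerivAt p (hLd p)).const_mul c
  have hfd := funext fun p => (hd p).fderiv
  refine ⟨fun p => (hd p).differentiableAt, ⟨|c|, fun p => ?_⟩, ⟨|c| * ‖L‖, fun p => ?_⟩,
    ⟨‖c‖₊ * (2 * ‖L‖₊ * ‖L‖₊), LipschitzWith.of_dist_le_mul fun p q => ?_⟩⟩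
  · rw [abs_mul, abs_of_nonneg (saturatedSq_nonneg _)]
    exact mul_le_of_le_one_right (abs_nonneg c) (saturatedSq_le_one _)
  · rw [hfd, norm_smul, norm_smul]
    exact mul_le_mul_of_nonneg_left
      (mul_le_of_le_one_left (norm_nonneg _) (abs_saturatedSqDeriv_le _)) (abs_nonneg c)
  · simp only [hfd]
    have h0 : c • saturatedSqDeriv (a * p.1 + b * p.2 + d) • L -
        c • saturatedSqDeriv (a * q.1 + b * q.2 + d) • L =
        (c * (saturatedSqDeriv (a * p.1 + b * p.2 + d) -
          saturatedSqDeriv (a * q.1 + b * q.2 + d))) • L := by module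
    rw [dist_eq_norm, h0, norm_smul, norm_mul]
    have h1 := lipschitzWith_saturatedSqDeriv.dist_le_mul (a * p.1 + b * p.2 + d)
      (a * q.1 + b * q.2 + d)
    have h2 : dist (a * p.1 + b * p.2 + d) (a * q.1 + b * q.2 + d) ≤ ‖L‖ * dist p q := by
      rw [dist_add_right, dist_eq_norm, dist_eq_norm]
      simpa [hL] using! L.le_opNorm (p - q) |>.trans_eq' (by simp [hL]; ring_nf)
    rw [dist_eq_norm] at h1
    have h3 : ‖saturatedSqDeriv (a * p.1 + b * p.2 + d) - saturatedSqDeriv (a * q.1 + b * q.2 + d)‖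
        ≤ 2 * (‖L‖ * dist p q) := by
      refine h1.trans ?_
      simpa using h2
    push_cast
    calc ‖c‖ * _ * ‖L‖ ≤ ‖c‖ * (2 * (‖L‖ * dist p q)) * ‖L‖ := by gcongr
      _ = _ := by simp; ring

/-! ### The two parts of the half Laplacian -/

theorem halfLaplacianNear_eq {φ : ℝ × ℝ → ℝ} (hφ : IsTestFunction φ) (δ : ℝ≥0∞) (t x : ℝ) :
    halfLaplacianNear δ (fun y => φ (t, y)) x = ∫ z in {z : ℝ | edist 0 z < δ},
      (2 * φ (t, x) - φ (t, x + z) - φ (t, x - z)) / (2 * z ^ 2) :=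
  (tendsto_halfLaplacianAnnulus hφ δ t x).limUnder_eq

/-- After symmetrization the singularity cancels: the integrand is bounded by `L` on a ball of
volume `2 * δ`. -/
theorem abs_halfLaplacianNear_le {φ : ℝ × ℝ → ℝ} (hφ : IsTestFunction φ) {δ L : ℝ} (hδ : 0 < δ)
    (hL : 0 ≤ L) {t x : ℝ}
    (h : ∀ z, |2 * φ (t, x) - φ (t, x + z) - φ (t, x - z)| ≤ 2 * L * z ^ 2) :
    |halfLaplacianNear (ENNReal.ofReal δ) (fun y => φ (t, y)) x| ≤ L * (2 * δ) := by
  have hs : {z : ℝ | edist 0 z < ENNReal.ofReal δ} = Metric.ball 0 δ := by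
    ext z
    rw [mem_ofPred_eq, edist_comm, Metric.mem_ball, edist_dist, ENNReal.ofReal_lt_ofReal_iff hδ]
  rw [halfLaplacianNear_eq hφ, hs]
  have := norm_setIntegral_le_of_norm_le_const (μ := volume) (s := Metric.ball (0 : ℝ) δ)
    (f := fun z => (2 * φ (t, x) - φ (t, x + z) - φ (t, x - z)) / (2 * z ^ 2)) (C := L)
    measure_ball_lt_top fun z _ => by
      rw [Real.norm_eq_abs, abs_div, abs_of_nonneg (by positivity : 0 ≤ 2 * z ^ 2)]
      exact div_le_of_le_mul₀ (by positivity) hL ((h z).trans_eq (by ring))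
  refine this.trans_eq ?_
  rw [Measure.real, Real.volume_ball, ENNReal.toReal_ofReal (by positivity)]

theorem measurableSet_le_edist (δ : ℝ≥0∞) : MeasurableSet {z : ℝ | δ ≤ edist 0 z} :=
  measurableSet_le measurable_const (by fun_prop)

theorem halfLaplacianFar_eq (δ : ℝ≥0∞) (f : ℝ → ℝ) (x : ℝ) :
    halfLaplacianFar δ f x = ∫ z in {z : ℝ | δ ≤ edist 0 z}, (f x - f (x + z)) / z ^ 2 := by
  have hs : (fun z : ℝ => x + z) ⁻¹' {y : ℝ | δ ≤ edist x y} = {z : ℝ | δ ≤ edist 0 z} := by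
    ext z
    have : edist x (x + z) = edist 0 z := by
      rw [edist_dist, edist_dist, Real.dist_eq, Real.dist_eq]; simp
    simp [this]
  have := (measurePreserving_add_left volume x).setIntegral_preimage_emb
    (measurableEmbedding_addLeft x) (fun y => (f x - f y) / (x - y) ^ 2) {y : ℝ | δ ≤ edist x y}
  rw [halfLaplacianFar, ← this, hs]
  simp

theorem integrableOn_inv_sq {δ : ℝ} (hδ : 0 < δ) :
    IntegrableOn (fun z : ℝ => 1 / z ^ 2) {z : ℝ | ENNReal.ofReal δ ≤ edist 0 z} := by
  refine Integrable.mono' (integrable_inv_one_add_sq.const_mul (1 + 1 / δ ^ 2)).integrableOn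
    (Measurable.aestronglyMeasurable (by fun_prop)) ?_
  refine (ae_restrict_iff' (measurableSet_le_edist _)).2 (Eventually.of_forall fun z hz => ?_)
  rw [mem_ofPred_eq, edist_dist, ENNReal.ofReal_le_ofReal_iff dist_nonneg, Real.dist_eq, zero_sub,
    abs_neg] at hz
  have hz2 : δ ^ 2 ≤ z ^ 2 := by rw [← sq_abs z]; gcongr
  have hzp : 0 < z ^ 2 := lt_of_lt_of_le (by positivity) hz2
  rw [Real.norm_eq_abs, abs_of_pos (by positivity), div_le_iff₀ hzp, ← div_eq_mul_inv,
    div_mul_eq_mul_div, one_le_div (by positivity)]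
  have : 1 ≤ 1 / δ ^ 2 * z ^ 2 := by
    rw [div_mul_eq_mul_div, one_le_div (by positivity)]; linarith
  linarith

/-- The integral of `1 / z²` over `|z| ≥ δ`. -/
def farMass (δ : ℝ) : ℝ := ∫ z in {z : ℝ | ENNReal.ofReal δ ≤ edist 0 z}, 1 / z ^ 2

theorem integrableOn_farKernel {δ C : ℝ} (hδ : 0 < δ) {f : ℝ → ℝ} (hf : Measurable f)
    (hC : ∀ y, |f y| ≤ C) (x : ℝ) :
    IntegrableOn (fun z => (f x - f (x + z)) / z ^ 2)
      {z : ℝ | ENNReal.ofReal δ ≤ edist 0 z} := by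
  refine ((integrableOn_inv_sq hδ).const_mul (2 * C)).mono'
    (Measurable.aestronglyMeasurable (by fun_prop)) (Eventually.of_forall fun z => ?_)
  rw [Real.norm_eq_abs, abs_div, abs_of_nonneg (sq_nonneg z), mul_one_div]
  gcongr
  exact (abs_sub _ _).trans (by linarith [hC x, hC (x + z)])

theorem abs_halfLaplacianFar_le {δ C : ℝ} (hδ : 0 < δ) {f : ℝ → ℝ} (hC : ∀ y, |f y| ≤ C) (x : ℝ) :
    |halfLaplacianFar (ENNReal.ofReal δ) f x| ≤ 2 * C * farMass δ := by
  rw [halfLaplacianFar_eq, farMass, ← integral_const_mul, ← Real.norm_eq_abs]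
  refine norm_integral_le_of_norm_le (((integrableOn_inv_sq hδ)).const_mul (2 * C))
    (Eventually.of_forall fun z => ?_)
  rw [Real.norm_eq_abs, abs_div, abs_of_nonneg (sq_nonneg z), mul_one_div]
  gcongr
  exact (abs_sub _ _).trans (by linarith [hC x, hC (x + z)])

/-- The integral of `min 1 (|z| / R) / z²` over `|z| ≥ δ`. -/
def truncatedMass (δ R : ℝ) : ℝ :=
  ∫ z in {z : ℝ | ENNReal.ofReal δ ≤ edist 0 z}, min 1 (|z| / R) * (1 / z ^ 2)

theorem integrableOn_truncatedMass {δ R : ℝ} (hδ : 0 < δ) (hR : 0 < R) :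
    IntegrableOn (fun z : ℝ => min 1 (|z| / R) * (1 / z ^ 2))
      {z : ℝ | ENNReal.ofReal δ ≤ edist 0 z} := by
  refine (integrableOn_inv_sq hδ).mono' (Measurable.aestronglyMeasurable (by fun_prop))
    (Eventually.of_forall fun z => ?_)
  rw [Real.norm_eq_abs, abs_of_nonneg (by positivity)]
  exact mul_le_of_le_one_left (by positivity) (min_le_left _ _)

/-- Dominated convergence with majorant `1 / z²`; this removes the effect of the spatial penalty on
the nonlocal terms, for fixed `δ`. -/
theorem tendsto_truncatedMass {δ : ℝ} (hδ : 0 < δ) :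
    Tendsto (truncatedMass δ) atTop (𝓝 0) := by
  have : (0 : ℝ) = ∫ z in {z : ℝ | ENNReal.ofReal δ ≤ edist 0 z}, (0 : ℝ) := by simp
  rw [this]
  refine tendsto_integral_filter_of_dominated_convergence (fun z => 1 / z ^ 2) ?_ ?_
    (integrableOn_inv_sq hδ) ?_
  · exact Eventually.of_forall fun R => Measurable.aestronglyMeasurable (by fun_prop)
  · filter_upwards [eventually_gt_atTop 0] with R hR
    refine Eventually.of_forall fun z => ?_
    rw [Real.norm_eq_abs, abs_of_nonneg (by positivity)]
    exact mul_le_of_le_one_left (by positivity) (min_le_left _ _)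
  · refine Eventually.of_forall fun z => ?_
    have h1 : Tendsto (fun R : ℝ => |z| / R) atTop (𝓝 0) := tendsto_const_nhds.div_atTop tendsto_id
    have h2 := ((tendsto_const_nhds (x := (1 : ℝ))).min h1).mul_const (1 / z ^ 2)
    rwa [min_eq_right zero_le_one, zero_mul] at h2

/-- Hypothesis `h` is maximality tested against simultaneous translations of both points by `z`. It
bounds the difference of the two integrands pointwise by the increment of the spatial penalty alone.
-/
theorem halfLaplacianFar_sub_le {δ C K R : ℝ} (hδ : 0 < δ) (hR : 0 < R) (hK : 0 ≤ K)
    {f g : ℝ → ℝ} (hf : Measurable f)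
    (hg : Measurable g) (hfC : ∀ y, |f y| ≤ C) (hgC : ∀ y, |g y| ≤ C) {x y : ℝ}
    (h : ∀ z, f (y + z) - g (x + z) - K * saturatedSq ((y + z) / R) ≤
      f y - g x - K * saturatedSq (y / R)) :
    halfLaplacianFar (ENNReal.ofReal δ) g x - halfLaplacianFar (ENNReal.ofReal δ) f y ≤
      K * truncatedMass δ R := by
  rw [halfLaplacianFar_eq, halfLaplacianFar_eq, truncatedMass, ← integral_const_mul,
    ← integral_sub (integrableOn_farKernel hδ hg hgC x) (integrableOn_farKernel hδ hf hfC y)]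
  refine integral_mono ((integrableOn_farKernel hδ hg hgC x).sub
    (integrableOn_farKernel hδ hf hfC y)) ((integrableOn_truncatedMass hδ hR).const_mul K)
    fun z => ?_
  have h1 := abs_saturatedSq_sub_le ((y + z) / R) (y / R)
  have h2 : (y + z) / R - y / R = z / R := by ring
  rw [h2, abs_div, abs_of_pos hR] at h1
  have h3 := mul_le_mul_of_nonneg_left ((le_abs_self _).trans h1) hK
  simp only
  rw [← sub_div, div_eq_mul_one_div, ← mul_assoc]
  gcongr
  linarith [h z]

theorem IsTestFunction.continuous {φ : ℝ × ℝ → ℝ} (hφ : IsTestFunction φ) : Continuous φ :=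
  hφ.differentiable.continuous

/-! ### Barriers -/

/-- The test functions used to penalize: a multiple of the saturated distance to `(s, y)`, a term
that is coercive in space at scale `R`, and a term that is increasing in time. -/
def barrier (N s y K R η : ℝ) (p : ℝ × ℝ) : ℝ :=
  N * saturatedSq (p.1 - s) + N * saturatedSq (p.2 - y) +
    (K * saturatedSq (p.2 / R) + η * saturatedSq (p.1 + 1))

theorem isTestFunction_barrier (N s y K R η : ℝ) : IsTestFunction (barrier N s y K R η) := by
  have h := ((isTestFunction_saturatedSq N 1 0 (-s)).add
    (isTestFunction_saturatedSq N 0 1 (-y))).add ((isTestFunction_saturatedSq K 0 R⁻¹ 0).add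
    (isTestFunction_saturatedSq η 1 0 1))
  convert h using 1
  funext p
  simp [barrier, sub_eq_add_neg, div_eq_inv_mul]

theorem partialT_barrier (N s y K R η t x : ℝ) : partialT (barrier N s y K R η) t x =
    N * saturatedSqDeriv (t - s) + η * saturatedSqDeriv (t + 1) := by
  have h1 := ((hasDerivAt_saturatedSq (t - s)).comp_sub_const t s).const_mul N
  have h2 := ((hasDerivAt_saturatedSq (t + 1)).comp_add_const t 1).const_mul η
  exact ((h1.add_const (N * saturatedSq (x - y))).add
    (h2.const_add (K * saturatedSq (x / R)))).deriv

theorem partialX_barrier (N s y K R η t x : ℝ) : partialX (barrier N s y K R η) t x =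
    N * saturatedSqDeriv (x - y) + K * (saturatedSqDeriv (x / R) * (1 / R)) := by
  have h1 := ((hasDerivAt_saturatedSq (x - y)).comp_sub_const x y).const_mul N
  have h2 := ((hasDerivAt_saturatedSq (x / R)).comp x
    ((hasDerivAt_id x).div_const R)).const_mul K
  exact ((h1.const_add (N * saturatedSq (t - s))).add
    (h2.add_const (η * saturatedSq (t + 1)))).deriv

/-- Rescaling by `R ≥ 1` only flattens the spatial penalty, so the bound is uniform in `R`, which
can therefore be chosen last. -/
theorem abs_second_difference_barrier_le (N s y K η t x z : ℝ) {R : ℝ} (hR : 1 ≤ R) :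
    |2 * barrier N s y K R η (t, x) - barrier N s y K R η (t, x + z) -
      barrier N s y K R η (t, x - z)| ≤ 2 * (2 * (|N| + |K|)) * z ^ 2 := by
  have h1 := abs_second_difference_saturatedSq_le (x - y) z
  have h2 := abs_second_difference_saturatedSq_le (x / R) (z / R)
  have h3 : (z / R) ^ 2 ≤ z ^ 2 := by
    rw [div_pow]
    exact div_le_self (sq_nonneg z) (one_le_pow₀ hR)
  have e : 2 * barrier N s y K R η (t, x) - barrier N s y K R η (t, x + z) -
      barrier N s y K R η (t, x - z) =
      N * (2 * saturatedSq (x - y) - saturatedSq (x - y + z) - saturatedSq (x - y - z)) +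
      K * (2 * saturatedSq (x / R) - saturatedSq (x / R + z / R) -
        saturatedSq (x / R - z / R)) := by
    simp only [barrier]
    rw [← add_div, ← sub_div, sub_add_eq_add_sub, sub_right_comm x y z]
    ring
  rw [e]
  calc _ ≤ |N| * (4 * z ^ 2) + |K| * (4 * z ^ 2) := by
        refine (abs_add_le _ _).trans ?_
        rw [abs_mul, abs_mul]
        gcongr
        linarith
    _ = _ := by ring

theorem abs_halfLaplacianNear_barrier_le (N s y K η t x : ℝ) {R δ : ℝ} (hR : 1 ≤ R) (hδ : 0 < δ) :
    |halfLaplacianNear (ENNReal.ofReal δ) (fun x' => barrier N s y K R η (t, x')) x| ≤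
      2 * (|N| + |K|) * (2 * δ) :=
  abs_halfLaplacianNear_le (isTestFunction_barrier N s y K R η) hδ (by positivity)
    fun z => abs_second_difference_barrier_le N s y K η t x z hR

theorem tendsto_saturatedSq_div (x : ℝ) : Tendsto (fun R : ℝ => saturatedSq (x / R)) atTop (𝓝 0) := by
  simpa using! (continuous_saturatedSq.tendsto 0).comp
    ((tendsto_const_nhds (x := x)).div_atTop tendsto_id)

theorem abs_saturatedSqDeriv_div_le {R : ℝ} (hR : 0 < R) (x : ℝ) :
    |saturatedSqDeriv x * (1 / R)| ≤ 1 / R := by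
  rw [abs_mul, abs_of_pos (by positivity : 0 < 1 / R)]
  exact mul_le_of_le_one_left (by positivity) (abs_saturatedSqDeriv_le x)

theorem abs_le_of_saturatedSq_div_le {R x : ℝ} (hR : 0 < R) (h : saturatedSq (x / R) ≤ 1 / 2) :
    |x| ≤ R := by
  have := sq_le_of_saturatedSq_le h le_rfl
  norm_num at this
  rwa [abs_div, abs_of_pos hR, div_le_one hR] at this

/-! ### Semicontinuity -/

theorem upperSemicontinuous_neg {X : Type*} [TopologicalSpace X] {f : X → ℝ}
    (hf : LowerSemicontinuous f) : UpperSemicontinuous fun p => -f p :=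
  continuous_neg.comp_lowerSemicontinuous_antitone hf fun _ _ h => neg_le_neg h

theorem exists_isMaxOn_of_isCompact {X : Type*} [TopologicalSpace X] {f : X → ℝ}
    (hf : UpperSemicontinuous f) {S S' : Set X} (hS : IsCompact S) {p₀ : X} (hp₀ : p₀ ∈ S)
    (h : ∀ p ∈ S', p ∉ S → f p ≤ f p₀) : ∃ p ∈ S, IsMaxOn f S' p := by
  obtain ⟨p, hp, hmax⟩ := (hf.upperSemicontinuousOn S).exists_isMaxOn ⟨p₀, hp₀⟩ hS
  refine ⟨p, hp, fun q hq => ?_⟩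
  by_cases hqS : q ∈ S
  · exact hmax hqS
  · exact (h q hq hqS).trans (hmax hp₀)

/-! ### The maximum principle -/

/-- A bounded upper semicontinuous function that satisfies, in the viscosity sense, a differential
inequality whose nonlocal term is switched off at zero slope, is bounded by its initial values. -/
theorem le_of_viscosity_inequality {w : ℝ≥0 × ℝ → ℝ} (hw : UpperSemicontinuous w) {T : ℝ≥0}
    {C M : ℝ} (hC : ∀ t ≤ T, ∀ x, |w (t, x)| ≤ C) {G : ℝ → ℝ} (hG : ContinuousAt G 0)
    (hG0 : G 0 = 0)
    (H : ∀ φ : ℝ × ℝ → ℝ, IsTestFunction φ → ∀ (t : ℝ≥0) (x : ℝ), 0 < t → t ≤ T →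
      IsMaxOn (fun p : ℝ≥0 × ℝ => w p - φ ((p.1 : ℝ), p.2)) {p | p.1 ≤ T} (t, x) →
      partialT φ t x ≤ |G (partialX φ t x)| *
        (|halfLaplacianNear (ENNReal.ofReal 1) (fun y => φ (t, y)) x| +
          |halfLaplacianFar (ENNReal.ofReal 1) (fun y => w (t, y)) x|))
    (h0 : ∀ x, w (0, x) ≤ M) {t : ℝ≥0} (ht : t ≤ T) (x : ℝ) : w (t, x) ≤ M := by
  by_contra! hlt
  have hC0 : 0 ≤ C := (abs_nonneg _).trans (hC t ht x)
  set η := (w (t, x) - M) / 4 with hη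
  have hηp : 0 < η := by rw [hη]; linarith
  -- Outside `[-R, R]` the penalty exceeds `K / 2 > 2 * C`, more than the oscillation of `w`, so no
  -- maximum can escape there.
  set K := 4 * C + 1 with hK
  have hKp : 0 < K := by positivity
  set c := 2 / (1 + ((T : ℝ) + 1) ^ 2) ^ 2 with hc
  have hcp : 0 < c := by positivity
  -- Bounds the near and far nonlocal terms together, independently of `R`; then `R` is taken so
  -- large that the coefficient at slope `K / R` beats it.
  set B := 2 * K * 2 + 2 * C * farMass 1 with hB
  have hGev : ∀ᶠ q in 𝓝 (0 : ℝ), |G q| * B < η * c := by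
    have : Tendsto (fun q => |G q| * B) (𝓝 0) (𝓝 (|G 0| * B)) := hG.abs.mul_const B
    rw [hG0, abs_zero, zero_mul] at this
    exact this.eventually_lt_const (by positivity)
  obtain ⟨r, hr, hGr⟩ := Metric.eventually_nhds_iff.1 hGev
  obtain ⟨R, hR1, hRx, hRK, hRr⟩ : ∃ R : ℝ, 1 ≤ R ∧ |x| ≤ R ∧ K * saturatedSq (x / R) < η ∧
      K / R < r := by
    have h1 : Tendsto (fun R : ℝ => K * saturatedSq (x / R)) atTop (𝓝 0) := by
      simpa using (tendsto_saturatedSq_div x).const_mul K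
    have h2 : Tendsto (fun R : ℝ => K / R) atTop (𝓝 0) := tendsto_const_nhds.div_atTop tendsto_id
    exact ((eventually_ge_atTop 1).and ((eventually_ge_atTop |x|).and
      ((h1.eventually_lt_const hηp).and (h2.eventually_lt_const hr)))).exists
  have hRp : 0 < R := by linarith
  set φ := barrier 0 0 0 K R η with hφ
  have hφt : IsTestFunction φ := isTestFunction_barrier 0 0 0 K R η
  have hφv : ∀ t x, φ (t, x) = K * saturatedSq (x / R) + η * saturatedSq (t + 1) := by
    intro t x; simp [hφ, barrier]
  have hv : ∀ t : ℝ, 0 ≤ η * saturatedSq (t + 1) ∧ η * saturatedSq (t + 1) ≤ η := fun t =>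
    ⟨mul_nonneg hηp.le (saturatedSq_nonneg _),
      mul_le_of_le_one_right hηp.le (saturatedSq_le_one _)⟩
  have husc : UpperSemicontinuous (fun p : ℝ≥0 × ℝ => w p - φ ((p.1 : ℝ), p.2)) := by
    simp only [sub_eq_add_neg]
    refine hw.add (Continuous.upperSemicontinuous ?_)
    have := hφt.continuous
    fun_prop
  have hstart : M + 2 * η < w (t, x) - φ ((t : ℝ), x) := by
    rw [hφv]; linarith [(hv t).2]
  have hM : -C ≤ M := (abs_le.1 (hC 0 bot_le 0)).1.trans (h0 0)
  obtain ⟨⟨t₁, x₁⟩, ⟨⟨-, ht₁⟩, -⟩, hmax⟩ := exists_isMaxOn_of_isCompact husc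
    (S := Icc 0 T ×ˢ Icc (-R) R) (S' := {p | p.1 ≤ T}) (isCompact_Icc.prod isCompact_Icc)
    (p₀ := (t, x)) ⟨⟨bot_le, ht⟩, abs_le.1 hRx⟩ (by
      rintro ⟨t', x'⟩ ht' hS
      refine le_trans ?_ hstart.le
      have hx' : R < |x'| := by
        by_contra! h
        exact hS ⟨⟨bot_le, ht'⟩, abs_le.1 h⟩
      have : 1 / 2 < saturatedSq (x' / R) := by
        by_contra! h
        exact absurd (abs_le_of_saturatedSq_div_le hRp h) hx'.not_ge
      have h2 : K * (1 / 2) ≤ K * saturatedSq (x' / R) := by gcongr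
      simp only [hφv]
      linarith [(abs_le.1 (hC t' ht' x')).2, (hv t').1])
  have hge := hmax (show (t, x) ∈ {p : ℝ≥0 × ℝ | p.1 ≤ T} from ht)
  simp only [mem_ofPred_eq] at hge
  have ht₁p : 0 < t₁ := by
    refine pos_iff_ne_zero.2 fun h => ?_
    subst h
    rw [NNReal.coe_zero, hφv 0 x₁] at hge
    have := mul_nonneg hKp.le (saturatedSq_nonneg (x₁ / R))
    have h1 := (hv 0).1
    rw [zero_add] at h1
    linarith [h0 x₁]
  have hin := H φ hφt t₁ x₁ ht₁p ht₁ hmax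
  have hq : |G (partialX φ t₁ x₁)| * B < η * c := by
    refine hGr ?_
    rw [hφ, partialX_barrier, dist_zero_right, zero_mul, zero_add, Real.norm_eq_abs, abs_mul,
      abs_of_pos hKp]
    calc _ ≤ K * (1 / R) := by gcongr; exact abs_saturatedSqDeriv_div_le hRp _
      _ < r := by rwa [mul_one_div]
  have hnear := abs_halfLaplacianNear_barrier_le 0 0 0 K η t₁ x₁ hR1 one_pos
  rw [abs_zero, zero_add, mul_one, abs_of_pos hKp] at hnear
  have hfar := abs_halfLaplacianFar_le one_pos (hC t₁ ht₁) x₁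
  have hle : partialT φ t₁ x₁ ≤ |G (partialX φ t₁ x₁)| * B :=
    hin.trans (by rw [hB]; gcongr)
  rw [hφ, partialT_barrier, zero_mul, zero_add, ← hφ] at hle
  have := mul_le_mul_of_nonneg_left
    (le_saturatedSqDeriv_add_one t₁.2 (NNReal.coe_le_coe.2 ht₁)) hηp.le
  exact absurd (this.trans hle) (not_le.2 hq)

/-- The coefficient `σ(p) p`. -/
def mobility (σ : ℝ≥0 → ℝ≥0) (p : ℝ) : ℝ := (σ p.toNNReal : ℝ) * p

theorem continuous_mobility {σ : ℝ≥0 → ℝ≥0} (hσ : Continuous σ) : Continuous (mobility σ) := by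
  unfold mobility
  fun_prop

theorem mobility_nonneg (σ : ℝ≥0 → ℝ≥0) {p : ℝ} (hp : 0 ≤ p) : 0 ≤ mobility σ p := by
  unfold mobility
  positivity

theorem IsViscositySubsolution.le_of_initial_le {σ : ℝ≥0 → ℝ≥0} (hσ : Continuous σ)
    {u : ℝ≥0 × ℝ → ℝ} (hu : IsViscositySubsolution σ u) (hb : BoundedOnStrips u) {M : ℝ}
    (h0 : ∀ x, u (0, x) ≤ M) (t : ℝ≥0) (x : ℝ) : u (t, x) ≤ M := by
  obtain ⟨C, hC⟩ := hb t
  refine le_of_viscosity_inequality hu.usc hC (continuous_mobility hσ).continuousAt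
    (by simp [mobility]) (fun φ hφ t' x' ht' ht'T hmax => ?_) h0 le_rfl x
  have h := hu.le_zero t (ht'.trans_le ht'T) φ hφ (ENNReal.ofReal 1) (by simp) t' x' ht' ht'T hmax
  rw [viscosityOperator, ← mobility] at h
  set a := halfLaplacianNear (ENNReal.ofReal 1) (fun y => φ (t', y)) x'
  set b := halfLaplacianFar (ENNReal.ofReal 1) (fun y => u (t', y)) x'
  calc partialT φ t' x' ≤ -(mobility σ (partialX φ t' x') * (a + b)) := by linarith
    _ ≤ |mobility σ (partialX φ t' x') * (a + b)| := neg_le_abs _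
    _ = |mobility σ (partialX φ t' x')| * |a + b| := abs_mul _ _
    _ ≤ _ := by gcongr; exact abs_add_le a b

theorem halfLaplacianFar_neg (δ : ℝ≥0∞) (f : ℝ → ℝ) (x : ℝ) :
    halfLaplacianFar δ (fun y => -f y) x = -halfLaplacianFar δ f x := by
  rw [halfLaplacianFar, halfLaplacianFar, ← integral_neg]
  congr 1
  funext y
  ring

theorem halfLaplacianNear_neg {φ : ℝ × ℝ → ℝ} (hφ : IsTestFunction φ) (δ : ℝ≥0∞) (t x : ℝ) :
    halfLaplacianNear δ (fun y => -φ (t, y)) x = -halfLaplacianNear δ (fun y => φ (t, y)) x := by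
  rw [halfLaplacianNear_eq hφ, halfLaplacianNear_eq hφ.neg, ← integral_neg]
  congr 1
  funext y
  ring

/-- The maximum principle applied to `-u`. Negating the test function reverses the slope, whence the
coefficient `mobility σ (-p)`. -/
theorem IsViscositySupersolution.le_of_le_initial {σ : ℝ≥0 → ℝ≥0} (hσ : Continuous σ)
    {u : ℝ≥0 × ℝ → ℝ} (hu : IsViscositySupersolution σ u) (hb : BoundedOnStrips u) {M : ℝ}
    (h0 : ∀ x, M ≤ u (0, x)) (t : ℝ≥0) (x : ℝ) : M ≤ u (t, x) := by
  obtain ⟨C, hC⟩ := hb t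
  refine neg_le_neg_iff.1 (le_of_viscosity_inequality (G := fun p => mobility σ (-p))
    (upperSemicontinuous_neg hu.lsc)
    (T := t) (C := C) (by simpa using hC)
    ((continuous_mobility hσ).comp continuous_neg).continuousAt
    (by simp [mobility]) (fun φ hφ t' x' ht' ht'T hmax => ?_) (fun x => neg_le_neg (h0 x)) le_rfl x)
  have h := hu.zero_le t (ht'.trans_le ht'T) (fun p => -φ p) hφ.neg (ENNReal.ofReal 1) (by simp)
    t' x' ht' ht'T (fun p hp => by
      have := hmax hp
      simp only [mem_ofPred_eq] at this ⊢
      linarith)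
  rw [viscosityOperator, ← mobility, halfLaplacianNear_neg hφ] at h
  rw [halfLaplacianFar_neg]
  have e1 : partialT (fun p => -φ p) t' x' = -partialT φ t' x' := deriv.fun_neg
  have e2 : partialX (fun p => -φ p) t' x' = -partialX φ t' x' := deriv.fun_neg
  rw [e1, e2] at h
  set a := halfLaplacianNear (ENNReal.ofReal 1) (fun y => φ (t', y)) x'
  set b := halfLaplacianFar (ENNReal.ofReal 1) (fun y => u (t', y)) x'
  calc partialT φ t' x' ≤ mobility σ (-partialX φ t' x') * (-a + b) := by linarith
    _ ≤ |mobility σ (-partialX φ t' x') * (-a + b)| := le_abs_self _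
    _ = |mobility σ (-partialX φ t' x')| * |-a + b| := abs_mul _ _
    _ ≤ _ := by
      gcongr
      refine (abs_add_le _ _).trans_eq ?_
      rw [abs_neg, abs_neg]

/-! ### Separation near the initial time -/

/-- Semicontinuity gives the gap near a compact piece of the diagonal at time zero. To the right of
`b`, `u₁` is already within `m` of the supremum of its data, which dominates `u₂` at all times; to
the left of `a` the roles are exchanged, with the infimum of the data of `u₂`. -/
theorem exists_initial_separation {σ : ℝ≥0 → ℝ≥0} (hσ : Continuous σ) {u₁ u₂ : ℝ≥0 × ℝ → ℝ}
    (h₁ : IsViscositySupersolution σ u₁) (h₂ : IsViscositySubsolution σ u₂)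
    (hb₁ : BoundedOnStrips u₁) (hb₂ : BoundedOnStrips u₂) (hm₁ : MonotoneInSpace u₁)
    (hm₂ : MonotoneInSpace u₂) (h0 : ∀ x : ℝ, u₂ (0, x) ≤ u₁ (0, x)) {m : ℝ} (hm : 0 < m) :
    ∃ ρ > 0, ∀ (t s : ℝ≥0) (x y : ℝ), (t : ℝ) < ρ → (s : ℝ) < ρ → |x - y| < ρ →
      u₂ (t, x) - u₁ (s, y) < m := by
  obtain ⟨C₁, hC₁⟩ := hb₁ 0
  obtain ⟨C₂, hC₂⟩ := hb₂ 0
  have hbdd : BddAbove (range fun x => u₁ (0, x)) :=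
    ⟨C₁, by rintro _ ⟨x, rfl⟩; exact (abs_le.1 (hC₁ 0 le_rfl x)).2⟩
  have hbdd' : BddBelow (range fun x => u₂ (0, x)) :=
    ⟨-C₂, by rintro _ ⟨x, rfl⟩; exact (abs_le.1 (hC₂ 0 le_rfl x)).1⟩
  obtain ⟨b, hb⟩ : ∃ b, (⨆ x, u₁ (0, x)) - m < u₁ (0, b) :=
    exists_lt_of_lt_ciSup (sub_lt_self _ hm)
  obtain ⟨a, ha⟩ : ∃ a, u₂ (0, a) < (⨅ x, u₂ (0, x)) + m :=
    exists_lt_of_ciInf_lt (lt_add_of_pos_right _ hm)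
  have hsup : ∀ t x, u₂ (t, x) ≤ ⨆ x, u₁ (0, x) :=
    h₂.le_of_initial_le hσ hb₂ fun x => (h0 x).trans (le_ciSup hbdd x)
  have hinf : ∀ t x, (⨅ x, u₂ (0, x)) ≤ u₁ (t, x) :=
    h₁.le_of_le_initial hσ hb₁ fun x => (ciInf_le hbdd' x).trans (h0 x)
  have hbev : ∀ᶠ s in 𝓝 (0 : ℝ≥0), (⨆ x, u₁ (0, x)) - m < u₁ (s, b) :=
    (Continuous.prodMk_left b).continuousAt.eventually (h₁.lsc (0, b) _ hb)
  have haev : ∀ᶠ s in 𝓝 (0 : ℝ≥0), u₂ (s, a) < (⨅ x, u₂ (0, x)) + m :=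
    (Continuous.prodMk_left a).continuousAt.eventually (h₂.usc (0, a) _ ha)
  obtain ⟨ρ₁, hρ₁, hb'⟩ := Metric.eventually_nhds_iff.1 hbev
  obtain ⟨ρ₂, hρ₂, ha'⟩ := Metric.eventually_nhds_iff.1 haev
  have husc : UpperSemicontinuous fun p : (ℝ≥0 × ℝ) × (ℝ≥0 × ℝ) => u₂ p.1 + -u₁ p.2 :=
    (h₂.usc.comp continuous_fst).add
      ((upperSemicontinuous_neg h₁.lsc).comp continuous_snd)
  -- The extra `1` is room for `x`: in the remaining case `y < b` and `|x - y| < 1`.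
  have hcomp : IsCompact ((fun c : ℝ => (((0 : ℝ≥0), c), ((0 : ℝ≥0), c))) '' Icc a (b + 1)) :=
    isCompact_Icc.image (by fun_prop)
  obtain ⟨ρ₃, hρ₃, hsub⟩ := hcomp.exists_thickening_subset_open (husc.isOpen_preimage m) (by
    rintro _ ⟨c, -, rfl⟩
    simp only [mem_preimage, mem_Iio]
    linarith [h0 c])
  refine ⟨min (min ρ₁ ρ₂) (min ρ₃ 1), by positivity, fun t s x y ht hs hxy => ?_⟩
  simp only [lt_min_iff] at ht hs hxy
  have hd : ∀ r : ℝ≥0, dist r 0 = r := fun r => by simp [NNReal.dist_eq]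
  rcases le_or_gt b y with hy | hy
  · have h1 := hb' (y := s) (by rw [hd]; exact hs.1.1)
    have h2 : u₁ (s, b) ≤ u₁ (s, y) := hm₁ s hy
    linarith [hsup t x]
  rcases le_or_gt x a with hx | hx
  · have h1 := ha' (y := t) (by rw [hd]; exact ht.1.2)
    have h2 : u₂ (t, x) ≤ u₂ (t, a) := hm₂ t hx
    linarith [hinf s y]
  have hmem : ((t, x), (s, y)) ∈
      Metric.thickening ρ₃ ((fun c : ℝ => (((0 : ℝ≥0), c), ((0 : ℝ≥0), c))) '' Icc a (b + 1)) := by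
    refine Metric.mem_thickening_iff.2 ⟨_, ⟨x, ⟨hx.le, ?_⟩, rfl⟩, ?_⟩
    · linarith [(abs_lt.1 hxy.2.2).2]
    · simp only [Prod.dist_eq, hd, dist_self, max_lt_iff]
      refine ⟨⟨ht.2.1, hρ₃⟩, hs.2.1, ?_⟩
      rw [Real.dist_eq, abs_sub_comm]
      exact hxy.2.1
  have := hsub hmem
  simp only [mem_preimage, mem_Iio] at this
  linarith

/-! ### Doubling of variables -/

/-- The functional whose maximum is studied when the variables are doubled. -/
def doubledFunctional (u₁ u₂ : ℝ≥0 × ℝ → ℝ) (N K R η : ℝ) (P : (ℝ≥0 × ℝ) × (ℝ≥0 × ℝ)) : ℝ :=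
  u₂ P.1 - u₁ P.2 - barrier N P.2.1 P.2.2 K R η ((P.1.1 : ℝ), P.1.2)

theorem upperSemicontinuous_doubledFunctional {u₁ u₂ : ℝ≥0 × ℝ → ℝ}
    (h₁ : LowerSemicontinuous u₁) (h₂ : UpperSemicontinuous u₂) (N K R η : ℝ) :
    UpperSemicontinuous (doubledFunctional u₁ u₂ N K R η) := by
  unfold doubledFunctional
  simp only [sub_eq_add_neg]
  refine ((h₂.comp continuous_fst).add
    ((upperSemicontinuous_neg h₁).comp continuous_snd)).add
    (Continuous.upperSemicontinuous ?_)
  have := continuous_saturatedSq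
  unfold barrier
  fun_prop

/-- The two viscosity inequalities at a maximum of the doubled functional, subtracted. -/
theorem time_derivative_le_of_isMaxOn_doubledFunctional {σ : ℝ≥0 → ℝ≥0} {u₁ u₂ : ℝ≥0 × ℝ → ℝ}
    (h₁ : IsViscositySupersolution σ u₁) (h₂ : IsViscositySubsolution σ u₂)
    (hm₁ : MonotoneInSpace u₁) (hm₂ : MonotoneInSpace u₂) {T : ℝ≥0} {C : ℝ}
    (hC₁ : ∀ t ≤ T, ∀ x, |u₁ (t, x)| ≤ C) (hC₂ : ∀ t ≤ T, ∀ x, |u₂ (t, x)| ≤ C)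
    {N K R η δ : ℝ} (hN : 0 ≤ N) (hK : 0 ≤ K) (hR : 1 ≤ R) (hδ : 0 < δ)
    {t s : ℝ≥0} {x y : ℝ} (ht : 0 < t) (htT : t ≤ T) (hs : 0 < s) (hsT : s ≤ T) (hyx : y ≤ x)
    (hmax : IsMaxOn (doubledFunctional u₁ u₂ N K R η) {P | P.1.1 ≤ T ∧ P.2.1 ≤ T}
      ((t, x), (s, y))) :
    η * saturatedSqDeriv (t + 1) ≤
      mobility σ (N * saturatedSqDeriv (x - y)) * ((8 * N + 4 * K) * δ + K * truncatedMass δ R) +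
      |mobility σ (N * saturatedSqDeriv (x - y)) - mobility σ (N * saturatedSqDeriv (x - y) +
        K * (saturatedSqDeriv (x / R) * (1 / R)))| *
        (2 * (N + K) * (2 * δ) + 2 * C * farMass δ) := by
  have hδ' : 0 < ENNReal.ofReal δ := ENNReal.ofReal_pos.2 hδ
  have hT : 0 < T := ht.trans_le htT
  have hsub := h₂.le_zero T hT (barrier N s y K R η) (isTestFunction_barrier _ _ _ _ _ _)
    (ENNReal.ofReal δ) hδ' t x ht htT (fun p hp => by
      have := hmax (show (p, (s, y)) ∈ {P : (ℝ≥0 × ℝ) × (ℝ≥0 × ℝ) | P.1.1 ≤ T ∧ P.2.1 ≤ T} from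
        ⟨hp, hsT⟩)
      simp only [mem_ofPred_eq, doubledFunctional] at this ⊢
      linarith)
  -- As a function of `(s, y)` only the coupling terms vary, so the spatial and time penalties are
  -- dropped; `R` is then irrelevant.
  have hsuper := h₁.zero_le T hT (barrier (-N) t x 0 R 0) (isTestFunction_barrier _ _ _ _ _ _)
    (ENNReal.ofReal δ) hδ' s y hs hsT (fun p hp => by
      have := hmax (show ((t, x), p) ∈ {P : (ℝ≥0 × ℝ) × (ℝ≥0 × ℝ) | P.1.1 ≤ T ∧ P.2.1 ≤ T} from
        ⟨htT, hp⟩)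
      simp only [mem_ofPred_eq, doubledFunctional, barrier] at this ⊢
      rw [← neg_sub (t : ℝ) s, ← neg_sub x y, ← neg_sub (t : ℝ) p.1, ← neg_sub x p.2]
      simp only [saturatedSq_neg]
      linarith)
  rw [viscosityOperator, ← mobility, partialT_barrier, partialX_barrier] at hsub hsuper
  rw [← neg_sub (t : ℝ) s, ← neg_sub x y, saturatedSqDeriv_neg, saturatedSqDeriv_neg, neg_mul_neg,
    neg_mul_neg, zero_mul, zero_mul, add_zero, add_zero] at hsuper
  have hn₁ := abs_halfLaplacianNear_barrier_le (-N) t x 0 0 s y hR hδ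
  have hn₂ := abs_halfLaplacianNear_barrier_le N s y K η t x hR hδ
  rw [abs_neg, abs_of_nonneg hN, abs_zero, add_zero] at hn₁
  rw [abs_of_nonneg hN, abs_of_nonneg hK] at hn₂
  have hf₂ := abs_halfLaplacianFar_le hδ (hC₂ t htT) x
  have hf := halfLaplacianFar_sub_le (K := K) hδ (by linarith) hK (hm₂ t).measurable
    (hm₁ s).measurable (hC₂ t htT) (hC₁ s hsT) (x := y) (y := x) (R := R) (fun z => by
      have := hmax (show ((t, x + z), (s, y + z)) ∈
        {P : (ℝ≥0 × ℝ) × (ℝ≥0 × ℝ) | P.1.1 ≤ T ∧ P.2.1 ≤ T} from ⟨htT, hsT⟩)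
      simp only [mem_ofPred_eq, doubledFunctional, barrier, add_sub_add_right_eq_sub] at this
      linarith)
  set n₁ := halfLaplacianNear (ENNReal.ofReal δ) (fun y => barrier (-N) t x 0 R 0 (s, y)) y
  set n₂ := halfLaplacianNear (ENNReal.ofReal δ) (fun y' => barrier N s y K R η (t, y')) x
  set f₁ := halfLaplacianFar (ENNReal.ofReal δ) (fun y => u₁ (s, y)) y
  set f₂ := halfLaplacianFar (ENNReal.ofReal δ) (fun y => u₂ (t, y)) x
  set p := N * saturatedSqDeriv (x - y)
  set q := K * (saturatedSqDeriv (x / R) * (1 / R))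
  have hp : 0 ≤ p := mul_nonneg hN (saturatedSqDeriv_nonneg (sub_nonneg.2 hyx))
  -- The difference of the nonlocal products is split into `e1`, with a common coefficient whose
  -- sign allows the ordering to be used, and `e2`, where a crude bound suffices because the two
  -- coefficients are close.
  have e1 : mobility σ p * (n₁ - n₂ + (f₁ - f₂)) ≤
      mobility σ p * ((8 * N + 4 * K) * δ + K * truncatedMass δ R) := by
    refine mul_le_mul_of_nonneg_left ?_ (mobility_nonneg σ hp)
    linarith [(abs_le.1 hn₁).2, (abs_le.1 hn₂).1]
  have e2 : (mobility σ p - mobility σ (p + q)) * (n₂ + f₂) ≤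
      |mobility σ p - mobility σ (p + q)| * (2 * (N + K) * (2 * δ) + 2 * C * farMass δ) := by
    refine (le_abs_self _).trans ?_
    rw [abs_mul]
    gcongr
    exact (abs_add_le _ _).trans (add_le_add hn₂ hf₂)
  linarith

/-- The comparison principle. -/
theorem IsViscositySubsolution.le_supersolution {σ : ℝ≥0 → ℝ≥0} (hσ : Continuous σ)
    {u₁ u₂ : ℝ≥0 × ℝ → ℝ}
    (h₂ : IsViscositySubsolution σ u₂) (h₁ : IsViscositySupersolution σ u₁)
    (hb₁ : BoundedOnStrips u₁) (hb₂ : BoundedOnStrips u₂) (hm₁ : MonotoneInSpace u₁)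
    (hm₂ : MonotoneInSpace u₂) (h0 : ∀ x : ℝ, u₂ (0, x) ≤ u₁ (0, x)) (T : ℝ≥0) (x₀ : ℝ) :
    u₂ (T, x₀) ≤ u₁ (T, x₀) := by
  by_contra! hlt
  obtain ⟨C, hC₁, hC₂⟩ : ∃ C, (∀ t ≤ T, ∀ x, |u₁ (t, x)| ≤ C) ∧ ∀ t ≤ T, ∀ x, |u₂ (t, x)| ≤ C := by
    obtain ⟨C₁, hC₁⟩ := hb₁ T
    obtain ⟨C₂, hC₂⟩ := hb₂ T
    exact ⟨max C₁ C₂, fun t ht x => (hC₁ t ht x).trans (le_max_left _ _),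
      fun t ht x => (hC₂ t ht x).trans (le_max_right _ _)⟩
  have hC0 : 0 ≤ C := (abs_nonneg _).trans (hC₁ T le_rfl x₀)
  set η := (u₂ (T, x₀) - u₁ (T, x₀)) / 4 with hη
  have hηp : 0 < η := by rw [hη]; linarith
  obtain ⟨ρ, hρ, hsep⟩ := exists_initial_separation hσ h₁ h₂ hb₁ hb₂ hm₁ hm₂ h0
    (m := 2 * η) (by positivity)
  set K := 4 * C + 1 with hK
  have hKp : 0 < K := by positivity
  -- `K ≤ N` confines `y` once `x` is confined; the second condition brings the two points within
  -- the separation radius `ρ`.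
  obtain ⟨N, hNK, hNρ⟩ : ∃ N, K ≤ N ∧ 4 * C < N * ρ ^ 2 := by
    refine ⟨K + K / ρ ^ 2, le_add_of_nonneg_right (by positivity), ?_⟩
    rw [add_mul, div_mul_cancel₀ _ (by positivity)]
    have : 0 ≤ K * ρ ^ 2 := by positivity
    linarith
  have hNp : 0 < N := hKp.trans_le hNK
  set c := η * (2 / (1 + ((T : ℝ) + 1) ^ 2) ^ 2) with hc
  have hcp : 0 < c := by positivity
  obtain ⟨Gm, hGm⟩ : ∃ Gm, ∀ p ∈ Icc 0 N, mobility σ p ≤ Gm := by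
    obtain ⟨Gm, h⟩ := isCompact_Icc.bddAbove_image (K := Icc 0 N)
      (continuous_mobility hσ).continuousOn
    exact ⟨Gm, fun p hp => h ⟨p, hp, rfl⟩⟩
  -- The gain `c` is split into three errors. The order matters: `δ` depends on `N`, the tolerance
  -- `e` on `δ` through `farMass δ`, and `R` on all of them.
  obtain ⟨δ, hδ, hδc⟩ := exists_pos_mul_lt (by positivity : 0 < c / 3) (Gm * (8 * N + 4 * K))
  obtain ⟨e, he, hec⟩ := exists_pos_mul_lt (by positivity : 0 < c / 3)
    (2 * (N + K) * (2 * δ) + 2 * C * farMass δ)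
  -- The interval is symmetric because the perturbed slope `p + q` is not shown to be nonnegative
  -- here.
  obtain ⟨r, hr, hGr⟩ := Metric.uniformContinuousOn_iff.1
    (isCompact_Icc.uniformContinuousOn_of_continuous (s := Icc (-(N + K)) (N + K))
      (continuous_mobility hσ).continuousOn) e he
  obtain ⟨R, hR1, hRx, hRη, hRr, hRc⟩ : ∃ R : ℝ, 1 ≤ R ∧ |x₀| ≤ R ∧
      K * saturatedSq (x₀ / R) < η ∧ K / R < r ∧ Gm * (K * truncatedMass δ R) < c / 3 := by
    have h1 : Tendsto (fun R : ℝ => K * saturatedSq (x₀ / R)) atTop (𝓝 0) := by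
      simpa using (tendsto_saturatedSq_div x₀).const_mul K
    have h2 : Tendsto (fun R : ℝ => K / R) atTop (𝓝 0) := tendsto_const_nhds.div_atTop tendsto_id
    have h3 : Tendsto (fun R : ℝ => Gm * (K * truncatedMass δ R)) atTop (𝓝 0) := by
      simpa using ((tendsto_truncatedMass hδ).const_mul K).const_mul Gm
    exact ((eventually_ge_atTop 1).and ((eventually_ge_atTop |x₀|).and
      ((h1.eventually_lt_const hηp).and ((h2.eventually_lt_const hr).and
        (h3.eventually_lt_const (by positivity)))))).exists
  have hRp : 0 < R := by linarith
  have hηv : ∀ t : ℝ, 0 ≤ η * saturatedSq (t + 1) ∧ η * saturatedSq (t + 1) ≤ η := fun t =>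
    ⟨mul_nonneg hηp.le (saturatedSq_nonneg _),
      mul_le_of_le_one_right hηp.le (saturatedSq_le_one _)⟩
  have hNv : ∀ r, 0 ≤ N * saturatedSq r := fun r => mul_nonneg hNp.le (saturatedSq_nonneg _)
  have hKv : ∀ r, 0 ≤ K * saturatedSq r := fun r => mul_nonneg hKp.le (saturatedSq_nonneg _)
  set Φ := doubledFunctional u₁ u₂ N K R η with hΦ
  have hΦv : ∀ (t s : ℝ≥0) (x y : ℝ), Φ ((t, x), (s, y)) = u₂ (t, x) - u₁ (s, y) -
      (N * saturatedSq (t - s) + N * saturatedSq (x - y) +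
        (K * saturatedSq (x / R) + η * saturatedSq (t + 1))) := fun _ _ _ _ => rfl
  have hstart : 2 * η < Φ ((T, x₀), (T, x₀)) := by
    rw [hΦv, sub_self, sub_self, saturatedSq_zero]
    linarith [(hηv T).2]
  have hdiff : ∀ t ≤ T, ∀ s ≤ T, ∀ x y, u₂ (t, x) - u₁ (s, y) ≤ 2 * C := fun t ht s hs x y => by
    linarith [(abs_le.1 (hC₁ s hs y)).1, (abs_le.1 (hC₂ t ht x)).2]
  obtain ⟨⟨⟨t, x⟩, ⟨s, y⟩⟩, ⟨⟨⟨-, htT⟩, -⟩, ⟨-, hsT⟩, -⟩, hmax⟩ := exists_isMaxOn_of_isCompact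
    (upperSemicontinuous_doubledFunctional h₁.lsc h₂.usc N K R η)
    (S := (Icc 0 T ×ˢ Icc (-R) R) ×ˢ (Icc 0 T ×ˢ Icc (-(R + 1)) (R + 1)))
    (S' := {P | P.1.1 ≤ T ∧ P.2.1 ≤ T})
    ((isCompact_Icc.prod isCompact_Icc).prod (isCompact_Icc.prod isCompact_Icc))
    (p₀ := ((T, x₀), (T, x₀)))
    ⟨⟨⟨bot_le, le_rfl⟩, abs_le.1 hRx⟩, ⟨bot_le, le_rfl⟩,
      abs_le.1 (hRx.trans (le_add_of_nonneg_right zero_le_one))⟩ (by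
      rintro ⟨⟨t, x⟩, ⟨s, y⟩⟩ ⟨ht, hs⟩ hS
      refine le_trans ?_ (hstart.le.trans' (by positivity : (0 : ℝ) ≤ 2 * η))
      rw [← hΦ, hΦv]
      rcases le_or_gt |x| R with hx | hx
      · have hy : R + 1 < |y| := by
          by_contra! h
          exact hS ⟨⟨⟨bot_le, ht⟩, abs_le.1 hx⟩, ⟨bot_le, hs⟩, abs_le.1 h⟩
        have hxy : 1 / 2 < saturatedSq (x - y) := by
          by_contra! h
          have h1 := abs_le_of_saturatedSq_div_le (x := x - y) one_pos (by rwa [div_one])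
          have h2 := abs_sub_abs_le_abs_sub y x
          rw [abs_sub_comm] at h2
          linarith
        have h2 : N * (1 / 2) ≤ N * saturatedSq (x - y) := by gcongr
        linarith [hdiff t ht s hs x y, (hηv t).1, hNv (t - s), hKv (x / R)]
      · have hx2 : 1 / 2 < saturatedSq (x / R) := by
          by_contra! h
          exact absurd (abs_le_of_saturatedSq_div_le hRp h) hx.not_ge
        have h2 : K * (1 / 2) ≤ K * saturatedSq (x / R) := by gcongr
        linarith [hdiff t ht s hs x y, (hηv t).1, hNv (t - s), hNv (x - y)])
  simp only at htT hsT
  have hge : Φ ((T, x₀), (T, x₀)) ≤ Φ ((t, x), (s, y)) :=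
    hmax (show ((T, x₀), (T, x₀)) ∈ {P : (ℝ≥0 × ℝ) × (ℝ≥0 × ℝ) | P.1.1 ≤ T ∧ P.2.1 ≤ T} from
      ⟨le_rfl, le_rfl⟩)
  rw [hΦv t s] at hge
  have hclose : ∀ r, N * saturatedSq r ≤ 2 * C → |r| < ρ := by
    intro r hr
    have h1 : saturatedSq r ≤ 2 * C / N := by rwa [le_div_iff₀' hNp]
    have h2 : 2 * C / N ≤ 1 / 2 := by rw [div_le_iff₀ hNp]; linarith
    have h3 := sq_le_of_saturatedSq_le h1 h2
    refine abs_lt_of_sq_lt_sq (h3.trans_lt ?_) hρ.le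
    rw [← mul_div_assoc, div_lt_iff₀ hNp]
    linarith
  have hd := hdiff t htT s hsT x y
  have hts : |(t : ℝ) - s| < ρ := hclose _ (by linarith [hNv (x - y), hKv (x / R), (hηv t).1])
  have hxy : |x - y| < ρ := hclose _ (by linarith [hNv (t - s), hKv (x / R), (hηv t).1])
  have hbig : 2 * η ≤ u₂ (t, x) - u₁ (s, y) := by
    linarith [hNv (t - s), hNv (x - y), hKv (x / R), (hηv t).1]
  have htp : 0 < t := by
    refine pos_iff_ne_zero.2 fun h => ?_
    subst h
    rw [NNReal.coe_zero, zero_sub, abs_neg, NNReal.abs_eq] at hts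
    exact (hsep 0 s x y (by simpa using hρ) hts hxy).not_ge hbig
  have hsp : 0 < s := by
    refine pos_iff_ne_zero.2 fun h => ?_
    subst h
    rw [NNReal.coe_zero, sub_zero, NNReal.abs_eq] at hts
    exact (hsep t 0 x y hts (by simpa using hρ) hxy).not_ge hbig
  -- If `x < y`, moving `y` down to `x` does not increase `u₁` and removes a positive penalty,
  -- contradicting maximality.
  have hyx : y ≤ x := by
    by_contra! h
    have h1 : Φ ((t, x), (s, x)) ≤ Φ ((t, x), (s, y)) :=
      hmax (show ((t, x), (s, x)) ∈ {P : (ℝ≥0 × ℝ) × (ℝ≥0 × ℝ) | P.1.1 ≤ T ∧ P.2.1 ≤ T} from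
        ⟨htT, hsT⟩)
    rw [hΦv, hΦv, sub_self, saturatedSq_zero] at h1
    have h2 : u₁ (s, x) ≤ u₁ (s, y) := hm₁ s h.le
    have h3 : 0 < N * saturatedSq (x - y) := mul_pos hNp (saturatedSq_pos (sub_ne_zero.2 h.ne))
    linarith
  have hkey := time_derivative_le_of_isMaxOn_doubledFunctional h₁ h₂ hm₁ hm₂ hC₁ hC₂ hNp.le hKp.le
    hR1 hδ htp htT hsp hsT hyx hmax
  set p := N * saturatedSqDeriv (x - y) with hp
  set q := K * (saturatedSqDeriv (x / R) * (1 / R)) with hq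
  have hp0 : 0 ≤ p := mul_nonneg hNp.le (saturatedSqDeriv_nonneg (sub_nonneg.2 hyx))
  have hpN : p ≤ N := mul_le_of_le_one_right hNp.le ((le_abs_self _).trans
    (abs_saturatedSqDeriv_le _))
  have hqR : |q| ≤ K / R := by
    rw [hq, abs_mul, abs_of_pos hKp]
    exact (mul_le_mul_of_nonneg_left (abs_saturatedSqDeriv_div_le hRp _) hKp.le).trans_eq
      (mul_one_div K R)
  have hqK : |q| ≤ K := hqR.trans (div_le_self hKp.le hR1)
  have hq2 := abs_le.1 hqK
  have hG := hGr p ⟨by linarith, by linarith⟩ (p + q) ⟨by linarith, by linarith⟩ (by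
    rw [Real.dist_eq, sub_add_cancel_left, abs_neg]
    exact hqR.trans_lt hRr)
  rw [Real.dist_eq] at hG
  have hB : 0 ≤ 2 * (N + K) * (2 * δ) + 2 * C * farMass δ := by
    have : 0 ≤ farMass δ := integral_nonneg fun z => by positivity
    positivity
  have hτ : 0 ≤ truncatedMass δ R := integral_nonneg fun z => by positivity
  have e1 : mobility σ p * ((8 * N + 4 * K) * δ + K * truncatedMass δ R) ≤
      Gm * ((8 * N + 4 * K) * δ + K * truncatedMass δ R) :=
    mul_le_mul_of_nonneg_right (hGm p ⟨hp0, hpN⟩) (by positivity)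
  have e2 := mul_le_mul_of_nonneg_right hG.le hB
  have e3 := mul_le_mul_of_nonneg_left
    (le_saturatedSqDeriv_add_one t.2 (NNReal.coe_le_coe.2 htT)) hηp.le
  have e4 : c ≤ η * saturatedSqDeriv (t + 1) := e3
  linarith

/-! ### Translations in space -/

/-- The coefficients do not depend on `x` and both nonlocal parts commute with translations, so the
test function is simply translated back. -/
theorem IsViscositySubsolution.comp_add_space {σ : ℝ≥0 → ℝ≥0} {u : ℝ≥0 × ℝ → ℝ}
    (hu : IsViscositySubsolution σ u) (h : ℝ) :
    IsViscositySubsolution σ (fun p => u (p.1, p.2 + h)) := by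
  refine ⟨hu.usc.comp (g := fun p : ℝ≥0 × ℝ => (p.1, p.2 + h)) (by fun_prop),
    fun T hT φ hφ δ hδ t₀ x₀ ht₀ ht₀T hmax => ?_⟩
  have hφ' := hφ.comp_add_const (0, -h)
  have key := hu.le_zero T hT (fun p => φ (p + (0, -h))) hφ' δ hδ t₀ (x₀ + h) ht₀ ht₀T
    (fun p hp => by
      have := hmax (show (p.1, p.2 - h) ∈ {p : ℝ≥0 × ℝ | p.1 ≤ T} from hp)
      simpa [sub_eq_add_neg] using this)
  have e1 : partialT (fun p => φ (p + (0, -h))) t₀ (x₀ + h) = partialT φ t₀ x₀ := by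
    simp [partialT]
  have e2 : partialX (fun p => φ (p + (0, -h))) t₀ (x₀ + h) = partialX φ t₀ x₀ := by
    have := deriv_comp_add_const (fun y => φ ((t₀ : ℝ), y)) (-h) (x₀ + h)
    simpa [partialX] using this
  have e3 : halfLaplacianNear δ (fun y => φ (((t₀ : ℝ), y) + (0, -h))) (x₀ + h) =
      halfLaplacianNear δ (fun y => φ ((t₀ : ℝ), y)) x₀ := by
    have := halfLaplacianNear_eq hφ' δ t₀ (x₀ + h)
    rw [this, halfLaplacianNear_eq hφ]
    congr 1
    funext z
    simp only [Prod.mk_add_mk, add_zero, add_neg_cancel_right, add_right_comm x₀ h z,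
      add_sub_right_comm x₀ h z]
  have e4 : halfLaplacianFar δ (fun y => u (t₀, y)) (x₀ + h) =
      halfLaplacianFar δ (fun y => u (t₀, y + h)) x₀ := by
    simp only [halfLaplacianFar_eq, add_right_comm x₀ h]
  rwa [viscosityOperator, e1, e2, e3, e4] at key

/-! ### Envelopes -/

theorem isBoundedUnder_le_of_abs_le {X : Type*} {u : X → ℝ} {C : ℝ} {l : Filter X}
    (hC : ∀ᶠ q in l, |u q| ≤ C) :
    l.IsBoundedUnder (· ≤ ·) u :=
  ⟨C, eventually_map.2 (hC.mono fun _ h => (abs_le.1 h).2)⟩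

theorem isBoundedUnder_ge_of_abs_le {X : Type*} {u : X → ℝ} {C : ℝ} {l : Filter X}
    (hC : ∀ᶠ q in l, |u q| ≤ C) :
    l.IsBoundedUnder (· ≥ ·) u :=
  ⟨-C, eventually_map.2 (hC.mono fun _ h => (abs_le.1 h).1)⟩

section Envelope

variable {X : Type*} [TopologicalSpace X] {u : X → ℝ} {p : X} {C a : ℝ}

theorem upperEnvelope_le (hC : ∀ᶠ q in 𝓝 p, |u q| ≤ C) (h : ∀ᶠ q in 𝓝 p, u q ≤ a) :
    upperEnvelope u p ≤ a :=
  limsup_le_of_le (isBoundedUnder_ge_of_abs_le hC).isCoboundedUnder_le h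

theorem le_lowerEnvelope (hC : ∀ᶠ q in 𝓝 p, |u q| ≤ C) (h : ∀ᶠ q in 𝓝 p, a ≤ u q) :
    a ≤ lowerEnvelope u p :=
  le_liminf_of_le (isBoundedUnder_le_of_abs_le hC).isCoboundedUnder_ge h

theorem le_upperEnvelope (hC : ∀ᶠ q in 𝓝 p, |u q| ≤ C) : u p ≤ upperEnvelope u p :=
  le_of_forall_gt fun _ hb =>
    (eventually_lt_of_limsup_lt hb (isBoundedUnder_le_of_abs_le hC)).self_of_nhds

theorem lowerEnvelope_le (hC : ∀ᶠ q in 𝓝 p, |u q| ≤ C) : lowerEnvelope u p ≤ u p :=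
  le_of_forall_lt fun _ hb =>
    (eventually_lt_of_lt_liminf hb (isBoundedUnder_ge_of_abs_le hC)).self_of_nhds

end Envelope

theorem BoundedOnStrips.exists_eventually {u : ℝ≥0 × ℝ → ℝ} (hu : BoundedOnStrips u) (T : ℝ≥0) :
    ∃ C, ∀ t ≤ T, ∀ x, ∀ᶠ q in 𝓝 (t, x), |u q| ≤ C := by
  -- Neighbourhoods of points at time `T` reach later times, hence the larger strip.
  obtain ⟨C, hC⟩ := hu (T + 1)
  refine ⟨C, fun t ht x => ?_⟩
  have h1 : ∀ᶠ q : ℝ≥0 × ℝ in 𝓝 (t, x), q.1 < T + 1 :=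
    continuous_fst.continuousAt.eventually_lt_const (ht.trans_lt (lt_add_one T))
  exact h1.mono fun q hq => hC q.1 hq.le q.2

theorem BoundedOnStrips.eventually {u : ℝ≥0 × ℝ → ℝ} (hu : BoundedOnStrips u) (p : ℝ≥0 × ℝ) :
    ∃ C, ∀ᶠ q in 𝓝 p, |u q| ≤ C :=
  (hu.exists_eventually p.1).imp fun _ h => h p.1 le_rfl p.2

theorem BoundedOnStrips.le_upperEnvelope {u : ℝ≥0 × ℝ → ℝ} (hu : BoundedOnStrips u)
    (p : ℝ≥0 × ℝ) : u p ≤ upperEnvelope u p :=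
  (hu.eventually p).elim fun _ h => DysonSigma.le_upperEnvelope h

theorem BoundedOnStrips.lowerEnvelope_le {u : ℝ≥0 × ℝ → ℝ} (hu : BoundedOnStrips u)
    (p : ℝ≥0 × ℝ) : lowerEnvelope u p ≤ u p :=
  (hu.eventually p).elim fun _ h => DysonSigma.lowerEnvelope_le h

theorem BoundedOnStrips.upperEnvelope {u : ℝ≥0 × ℝ → ℝ} (hu : BoundedOnStrips u) :
    BoundedOnStrips (upperEnvelope u) := fun T => by
  obtain ⟨C, hC⟩ := hu.exists_eventually T
  refine ⟨C, fun t ht x => abs_le.2 ⟨?_, ?_⟩⟩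
  · exact (abs_le.1 (hC t ht x).self_of_nhds).1.trans (DysonSigma.le_upperEnvelope (hC t ht x))
  · exact upperEnvelope_le (hC t ht x) ((hC t ht x).mono fun q hq => (abs_le.1 hq).2)

theorem BoundedOnStrips.lowerEnvelope {u : ℝ≥0 × ℝ → ℝ} (hu : BoundedOnStrips u) :
    BoundedOnStrips (lowerEnvelope u) := fun T => by
  obtain ⟨C, hC⟩ := hu.exists_eventually T
  refine ⟨C, fun t ht x => abs_le.2 ⟨?_, ?_⟩⟩
  · exact le_lowerEnvelope (hC t ht x) ((hC t ht x).mono fun q hq => (abs_le.1 hq).1)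
  · exact (DysonSigma.lowerEnvelope_le (hC t ht x)).trans (abs_le.1 (hC t ht x).self_of_nhds).2

/-- Translation by `y - x` carries neighbourhoods of `(t, x)` to neighbourhoods of `(t, y)` and can
only increase `u`. -/
theorem MonotoneInSpace.upperEnvelope {u : ℝ≥0 × ℝ → ℝ} (hm : MonotoneInSpace u)
    (hu : BoundedOnStrips u) : MonotoneInSpace (upperEnvelope u) := fun t x y hxy => by
  obtain ⟨C, hC⟩ := hu.eventually (t, x)
  obtain ⟨C', hC'⟩ := hu.eventually (t, y)
  refine le_of_forall_gt_imp_ge_of_dense fun b hb => upperEnvelope_le hC ?_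
  have h1 := eventually_lt_of_limsup_lt hb (isBoundedUnder_le_of_abs_le hC')
  have hc : Tendsto (fun q : ℝ≥0 × ℝ => (q.1, q.2 + (y - x))) (𝓝 (t, x)) (𝓝 (t, y)) := by
    have : Continuous fun q : ℝ≥0 × ℝ => (q.1, q.2 + (y - x)) := by fun_prop
    simpa using this.tendsto (t, x)
  exact (hc.eventually h1).mono fun q hq => (hm q.1 (by linarith)).trans hq.le

theorem MonotoneInSpace.lowerEnvelope {u : ℝ≥0 × ℝ → ℝ} (hm : MonotoneInSpace u)
    (hu : BoundedOnStrips u) : MonotoneInSpace (lowerEnvelope u) := fun t x y hxy => by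
  obtain ⟨C, hC⟩ := hu.eventually (t, x)
  obtain ⟨C', hC'⟩ := hu.eventually (t, y)
  refine le_of_forall_lt_imp_le_of_dense fun b hb => le_lowerEnvelope hC' ?_
  have h1 := eventually_lt_of_lt_liminf hb (isBoundedUnder_ge_of_abs_le hC)
  have hc : Tendsto (fun q : ℝ≥0 × ℝ => (q.1, q.2 - (y - x))) (𝓝 (t, y)) (𝓝 (t, x)) := by
    have : Continuous fun q : ℝ≥0 × ℝ => (q.1, q.2 - (y - x)) := by fun_prop
    simpa using this.tendsto (t, y)
  exact (hc.eventually h1).mono fun q hq => hq.le.trans (hm q.1 (by linarith))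

/-- The value of `u₀` at an intermediate point separates the two envelopes. -/
theorem upperEnvelope_le_lowerEnvelope_of_lt {u₀ : ℝ → ℝ} (hu₀ : Monotone u₀) {x y : ℝ}
    (hxy : x < y) : upperEnvelope u₀ x ≤ lowerEnvelope u₀ y := by
  have hb : ∀ x, ∃ C, ∀ᶠ q in 𝓝 x, |u₀ q| ≤ C := fun x => by
    refine ⟨max (u₀ (x + 1)) (-u₀ (x - 1)), ?_⟩
    filter_upwards [Icc_mem_nhds (sub_one_lt x) (lt_add_one x)] with q hq
    exact abs_le.2 ⟨neg_le.1 ((neg_le_neg (hu₀ hq.1)).trans (le_max_right _ _)),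
      (hu₀ hq.2).trans (le_max_left _ _)⟩
  obtain ⟨C, hC⟩ := hb x
  obtain ⟨C', hC'⟩ := hb y
  obtain ⟨z, hxz, hzy⟩ := exists_between hxy
  exact (upperEnvelope_le hC ((eventually_le_nhds hxz).mono fun q hq => hu₀ hq)).trans
    (le_lowerEnvelope hC' ((eventually_ge_nhds hzy).mono fun q hq => hu₀ hq))

/-! ### Uniqueness -/

/-- Translating `u^*` by `x - y < 0` puts its initial values below those of `v_*`, even at jumps of
`u₀`, so comparison applies. -/
theorem IsViscositySolution.upperEnvelope_le_lowerEnvelope_of_lt {σ : ℝ≥0 → ℝ≥0}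
    (hσ : Continuous σ) {u₀ : ℝ → ℝ} (hu₀ : Monotone u₀) {u v : ℝ≥0 × ℝ → ℝ}
    (hu : IsViscositySolution σ u) (hv : IsViscositySolution σ v)
    (hbu : BoundedOnStrips u) (hbv : BoundedOnStrips v) (hmu : MonotoneInSpace u)
    (hmv : MonotoneInSpace v) (hiu : HasInitialDatum u u₀) (hiv : HasInitialDatum v u₀)
    (t : ℝ≥0) {x y : ℝ} (hxy : x < y) : upperEnvelope u (t, x) ≤ lowerEnvelope v (t, y) := by
  have h := (hu.upper.comp_add_space (x - y)).le_supersolution hσ hv.lower hbv.lowerEnvelope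
    (fun T => (hbu.upperEnvelope T).imp fun C hC t ht z => hC t ht _)
    (hmv.lowerEnvelope hbv)
    (fun s z w hzw => hmu.upperEnvelope hbu s (add_le_add_left hzw _)) (fun z => by
      rw [(hiv z).2, (hiu _).1]
      exact DysonSigma.upperEnvelope_le_lowerEnvelope_of_lt hu₀ (by linarith)) t y
  simpa using h

/-- Let `y` decrease to `x` in `u^*(t, x) ≤ v_*(t, y) ≤ v^*(t, y)`, using upper semicontinuity of
`v^*`. -/
theorem IsViscositySolution.upperEnvelope_le {σ : ℝ≥0 → ℝ≥0}
    (hσ : Continuous σ) {u₀ : ℝ → ℝ} (hu₀ : Monotone u₀) {u v : ℝ≥0 × ℝ → ℝ}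
    (hu : IsViscositySolution σ u) (hv : IsViscositySolution σ v)
    (hbu : BoundedOnStrips u) (hbv : BoundedOnStrips v) (hmu : MonotoneInSpace u)
    (hmv : MonotoneInSpace v) (hiu : HasInitialDatum u u₀) (hiv : HasInitialDatum v u₀) :
    upperEnvelope u ≤ upperEnvelope v := fun ⟨t, x⟩ => by
  refine le_of_forall_gt_imp_ge_of_dense fun b hb => ?_
  have h1 : ∀ᶠ y in 𝓝[>] x, upperEnvelope v (t, y) < b :=
    nhdsWithin_le_nhds ((Continuous.prodMk_right t).continuousAt.eventually
      (hv.upper.usc (t, x) b hb))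
  obtain ⟨y, hy, hxy⟩ := (h1.and self_mem_nhdsWithin).exists
  exact (hu.upperEnvelope_le_lowerEnvelope_of_lt hσ hu₀ hv hbu hbv hmu hmv hiu hiv t hxy).trans
    ((hbv.lowerEnvelope_le _).trans ((hbv.le_upperEnvelope _).trans hy.le))

/-- Let `y` increase to `x` in `u_*(t, y) ≤ u^*(t, y) ≤ v_*(t, x)`, using lower semicontinuity of
`u_*`. -/
theorem IsViscositySolution.lowerEnvelope_le {σ : ℝ≥0 → ℝ≥0}
    (hσ : Continuous σ) {u₀ : ℝ → ℝ} (hu₀ : Monotone u₀) {u v : ℝ≥0 × ℝ → ℝ}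
    (hu : IsViscositySolution σ u) (hv : IsViscositySolution σ v)
    (hbu : BoundedOnStrips u) (hbv : BoundedOnStrips v) (hmu : MonotoneInSpace u)
    (hmv : MonotoneInSpace v) (hiu : HasInitialDatum u u₀) (hiv : HasInitialDatum v u₀) :
    lowerEnvelope u ≤ lowerEnvelope v := fun ⟨t, x⟩ => by
  refine le_of_forall_lt_imp_le_of_dense fun b hb => ?_
  have h1 : ∀ᶠ y in 𝓝[<] x, b < lowerEnvelope u (t, y) :=
    nhdsWithin_le_nhds ((Continuous.prodMk_right t).continuousAt.eventually
      (hu.lower.lsc (t, x) b hb))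
  obtain ⟨y, hy, hyx⟩ := (h1.and self_mem_nhdsWithin).exists
  exact (hy.le.trans ((hbu.lowerEnvelope_le _).trans (hbu.le_upperEnvelope _))).trans
    (hu.upperEnvelope_le_lowerEnvelope_of_lt hσ hu₀ hv hbu hbv hmu hmv hiu hiv t hyx)

/-- The envelopes of a continuous datum coincide, so `u^*` and `v_*` are compared without a shift.
-/
theorem IsViscositySolution.le_of_continuous {σ : ℝ≥0 → ℝ≥0}
    (hσ : Continuous σ) {u₀ : ℝ → ℝ} (hu₀ : Continuous u₀) {u v : ℝ≥0 × ℝ → ℝ}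
    (hu : IsViscositySolution σ u) (hv : IsViscositySolution σ v)
    (hbu : BoundedOnStrips u) (hbv : BoundedOnStrips v) (hmu : MonotoneInSpace u)
    (hmv : MonotoneInSpace v) (hiu : HasInitialDatum u u₀) (hiv : HasInitialDatum v u₀) :
    u ≤ v := fun ⟨t, x⟩ => by
  refine (hbu.le_upperEnvelope _).trans (le_trans ?_ (hbv.lowerEnvelope_le _))
  refine hu.upper.le_supersolution hσ hv.lower hbv.lowerEnvelope hbu.upperEnvelope
    (hmv.lowerEnvelope hbv) (hmu.upperEnvelope hbu) (fun z => ?_) t x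
  rw [(hiv z).2, (hiu z).1]
  exact ((hu₀.tendsto z).limsup_eq.trans (hu₀.tendsto z).liminf_eq.symm).le

/-- The shifted comparison gives `u (t, x) ≤ v (t, y)` for `y > x`; right continuity of `v` lets `y`
decrease to `x`. -/
theorem IsViscositySolution.le_of_rightContinuous {σ : ℝ≥0 → ℝ≥0}
    (hσ : Continuous σ) {u₀ : ℝ → ℝ} (hu₀ : Monotone u₀) {u v : ℝ≥0 × ℝ → ℝ}
    (hu : IsViscositySolution σ u) (hv : IsViscositySolution σ v)
    (hbu : BoundedOnStrips u) (hbv : BoundedOnStrips v) (hmu : MonotoneInSpace u)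
    (hmv : MonotoneInSpace v) (hiu : HasInitialDatum u u₀) (hiv : HasInitialDatum v u₀)
    (hr : RightContinuousInSpace v) : u ≤ v := fun ⟨t, x⟩ => by
  have h1 : Tendsto (fun y => v (t, y)) (𝓝[>] x) (𝓝 (v (t, x))) :=
    (hr t x).mono_left (nhdsWithin_mono x Ioi_subset_Ici_self)
  refine ge_of_tendsto h1 ?_
  filter_upwards [self_mem_nhdsWithin] with y hy
  exact (hbu.le_upperEnvelope _).trans ((hu.upperEnvelope_le_lowerEnvelope_of_lt hσ hu₀ hv hbu hbv
    hmu hmv hiu hiv t hy).trans (hbv.lowerEnvelope_le _))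

end DysonSigma

end

theorem mainTheorem9 (σ : ℝ≥0 → ℝ≥0) (hσ : Continuous σ) :
    (∀ u₁ u₂ : ℝ≥0 × ℝ → ℝ,
      DysonSigma.IsViscositySupersolution σ u₁ → DysonSigma.IsViscositySubsolution σ u₂ →
      DysonSigma.BoundedOnStrips u₁ → DysonSigma.BoundedOnStrips u₂ →
      DysonSigma.MonotoneInSpace u₁ → DysonSigma.MonotoneInSpace u₂ →
      (∀ x : ℝ, u₂ (0, x) ≤ u₁ (0, x)) →
      ∀ (t : ℝ≥0) (x : ℝ), u₂ (t, x) ≤ u₁ (t, x)) ∧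
    (∀ u₀ : ℝ → ℝ, Monotone u₀ → ∀ u v : ℝ≥0 × ℝ → ℝ,
      DysonSigma.IsViscositySolution σ u → DysonSigma.IsViscositySolution σ v →
      DysonSigma.BoundedOnStrips u → DysonSigma.BoundedOnStrips v →
      DysonSigma.MonotoneInSpace u → DysonSigma.MonotoneInSpace v →
      DysonSigma.HasInitialDatum u u₀ → DysonSigma.HasInitialDatum v u₀ →
      DysonSigma.upperEnvelope u = DysonSigma.upperEnvelope v ∧
      DysonSigma.lowerEnvelope u = DysonSigma.lowerEnvelope v ∧
      (Continuous u₀ → u = v) ∧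
      (DysonSigma.RightContinuousInSpace u → DysonSigma.RightContinuousInSpace v → u = v)) := by
  refine ⟨fun u₁ u₂ h₁ h₂ hb₁ hb₂ hm₁ hm₂ h0 => h₂.le_supersolution hσ h₁ hb₁ hb₂ hm₁ hm₂ h0,
    fun u₀ hu₀ u v hu hv hbu hbv hmu hmv hiu hiv => ⟨?_, ?_, fun hc => ?_, fun hru hrv => ?_⟩⟩
  · exact (hu.upperEnvelope_le hσ hu₀ hv hbu hbv hmu hmv hiu hiv).antisymm
      (hv.upperEnvelope_le hσ hu₀ hu hbv hbu hmv hmu hiv hiu)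
  · exact (hu.lowerEnvelope_le hσ hu₀ hv hbu hbv hmu hmv hiu hiv).antisymm
      (hv.lowerEnvelope_le hσ hu₀ hu hbv hbu hmv hmu hiv hiu)
  · exact (hu.le_of_continuous hσ hc hv hbu hbv hmu hmv hiu hiv).antisymm
      (hv.le_of_continuous hσ hc hu hbv hbu hmv hmu hiv hiu)
  · exact (hu.le_of_rightContinuous hσ hu₀ hv hbu hbv hmu hmv hiu hiv hrv).antisymm
      (hv.le_of_rightContinuous hσ hu₀ hu hbv hbu hmv hmu hiv hiu hru)
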